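/- Let $p\ge 1$ be an integer, let $m>0$ be irrational, and let $k_0\ge 2$ be an integer. For real $s>1$ let $X^s$ be the space of real-valued functions $v(t,x)=\sum_{n\in\mathbb Z,\,k\ge 1}c_{n,k}e^{int}\sin(kx)$ with $\overline{c_{n,k}}=c_{-n,k}$ and $$\|v\|_{X^s}^2:=\sum_{n\in\mathbb Z,\,k\ge 1}\bigl(|n|^{2s}+k^{2s}\bigr)|c_{n,k}|^2<\infty .$$ Consider, for $\alpha>0$, the damped nonlinear wave equation $$\partial_t^2u-\partial_x^2u-\alpha\,\partial_t\partial_x^2u+mu=(\partial_tu)^{2p+1},\qquad t\in\mathbb R,\ x\in\mathbb R/2\pi\mathbb Z,\qquad u(t,0)=u(t,\pi)=0. \tag{1}$$ Then there are constants $M,c,C>0$, depending only on $p,m,k_0$, and for each $\rho\in(0,M)$ there are numbers $\alpha=\alpha(\rho)\ge c\,\rho^{2p}$ and $\omega=\omega(\rho)>0$ with $1<\omega^2<m+2$, such that (1) with damping $\alpha$ has a classical solution $u$ which is $2\pi/\omega$-periodic in $t$, of class $C^{k_0}$ in $(t,x)$, and of the form $$u(t,x)=\rho\cos(\omega t)\sin(x)+v(\omega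 t,x),$$ where $v(t,x)$ is $2\pi$-periodic in $t$, $v\in X^s$, and $\|v\|_{X^s}\le C\rho^{2p+\frac12}$ for every real $s\in[k_0+10,k_0+20]$. (Classical means that all partial derivatives in (1) exist and that (1) holds at every point.) Moreover $\alpha(\rho)\to 0$ (through positive values) and $\omega(\rho)^2\to 1+m$ as $\rho\downarrow 0$. -/

import Mathlib

open Filter Topology

noncomputable section

/-- `u(t,x)` is a classical solution, on all of `ℝ × ℝ`, of
`u_tt - u_xx - α ∂_t ∂_x² u + m u = (u_t)^(2p+1)`: every partial derivative occurring in the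
equation exists at every point (as a genuine derivative, not as a default value), and the equation
holds at every point. -/
def SolvesDampedWave (p : ℕ) (α m : ℝ) (u : ℝ → ℝ → ℝ) : Prop :=
  ∃ ut utt ux uxx utxx : ℝ → ℝ → ℝ,
    (∀ t x, HasDerivAt (fun τ => u τ x) (ut t x) t) ∧
    (∀ t x, HasDerivAt (fun τ => ut τ x) (utt t x) t) ∧
    (∀ t x, HasDerivAt (fun y => u t y) (ux t x) x) ∧
    (∀ t x, HasDerivAt (fun y => ux t y) (uxx t x) x) ∧
    (∀ t x, HasDerivAt (fun τ => uxx τ x) (utxx t x) t) ∧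
    ∀ t x, utt t x - uxx t x - α * utxx t x + m * u t x = ut t x ^ (2 * p + 1)

/-- The weight `n^(2s) + k^(2s)`. -/
def xsWeight (s : ℝ) (q : ℤ × ℕ+) : ℝ :=
  |(q.1 : ℝ)| ^ (2 * s) + ((q.2 : ℕ) : ℝ) ^ (2 * s)

/-- `v` belongs to the space `X^s` of real functions
`v(t,x) = ∑_{n ∈ ℤ, k ≥ 1} c_{n,k} e^{int} sin(kx)` with `conj c_{n,k} = c_{-n,k}` and
`∑ (n^(2s) + k^(2s)) |c_{n,k}|² < ∞`, and `c` is its family of coefficients.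
(Used only for `s > 1`, where the series converges absolutely and uniformly, so that `v`
determines `c`.) -/
structure IsXsExpansion (s : ℝ) (c : ℤ × ℕ+ → ℂ) (v : ℝ → ℝ → ℝ) : Prop where
  conj_coeff : ∀ (n : ℤ) (k : ℕ+), (starRingEnd ℂ) (c (n, k)) = c (-n, k)
  summable_weight : Summable fun q : ℤ × ℕ+ => xsWeight s q * ‖c q‖ ^ 2
  hasSum : ∀ t x : ℝ,
    HasSum (fun q : ℤ × ℕ+ =>
        c q * Complex.exp (Complex.I * (q.1 : ℂ) * (t : ℂ)) * (Real.sin ((q.2 : ℕ) * x) : ℂ))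
      (v t x : ℂ)

/-- The Sobolev norm of the element of `X^s` with coefficients `c`:
`(∑ (n^(2s) + k^(2s)) |c_{n,k}|²)^(1/2)`. -/
def xsNorm (s : ℝ) (c : ℤ × ℕ+ → ℂ) : ℝ :=
  Real.sqrt (∑' q : ℤ × ℕ+, xsWeight s q * ‖c q‖ ^ 2)

/-- `v ∈ X^s` and `‖v‖_{X^s} ≤ B`. -/
def XsNormLE (s : ℝ) (v : ℝ → ℝ → ℝ) (B : ℝ) : Prop :=
  ∃ c : ℤ × ℕ+ → ℂ, IsXsExpansion s c v ∧ xsNorm s c ≤ B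

end

/-!
The solution is sought as `u(t, x) = ρ w(ωt, x)`. With `ε = ρ ^ (2p)`, `ω² = 1 + m + ε η` and `α ω
= ε γ`, the equation for `w` is `ω² w_tt - w_xx - ε γ ∂_t ∂_x² w + m w = ε ω ^ (2p+1) (∂_t w) ^
(2p+1)`, and the unknown is `y = ∂_t w = -sin t sin x + Y`, in a weighted Wiener algebra `Wiener`
of double Fourier series. At `ε = 0` the linear operator has the symbol `k² + m - (1 + m) n²`,
which for irrational `m` vanishes only at the four indices `|n| = |k| = 1`
(`undampedSymbol_ne_zero`). By the symmetries of real functions that are odd in `x`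
(`IsAdmissible`), the four kernel equations reduce to the complex one `γ + i η = 4 F(1, 1)`, where
`F(1, 1)` is a coefficient of `ω ^ (2p+1) y ^ (2p+1)`; it determines the damping and the
frequency. It gives `γ > 0` because the powers of `cos t cos x` have nonnegative coefficients
(`exists_coef_convPow_profile`).

Off the kernel, the inverse of the operator is only bounded by a multiple of `1 / ε`, which
cancels the factor `ε` of the nonlinearity; the contraction comes from the regularizing effect of
the damping (`exists_forall_abs_le_dampedSymbol`). Away from the cone `k² ~ (1 + m) n²` the
operator is elliptic. Close to it the divisor is at least of order `ε |n| k²`, so that `ε ∂_t`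
composed with the inverse gains `1 / k²`, which is small except at finitely many indices; there
the undamped divisors are bounded below, and the factor `ε` is small. Hence `(Y, γ, η)` is a fixed
point of a contraction (`exists_coefficients`). Since `(-sin t sin x) ^ (2p+1)` is a trigonometric
polynomial, its image under `ε ∂_t` composed with the inverse is `O(ε)`, and so is `Y`.

The weight is exponential, hence the Fourier series can be differentiated at will and all the
Sobolev norms are controlled by the norm of `Wiener`.
-/

noncomputable section

/-! ### A weighted Wiener algebra -/

/-- The submultiplicative weight `2 ^ (|n| + |k|)` on the Fourier indices `(n, k)`. -/
def expWeight (q : ℤ × ℤ) : ℝ := 2 ^ (q.1.natAbs + q.2.natAbs)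

theorem expWeight_pos (q : ℤ × ℤ) : 0 < expWeight q := by unfold expWeight; positivity

theorem one_le_expWeight (q : ℤ × ℤ) : 1 ≤ expWeight q := one_le_pow₀ (by norm_num)

theorem expWeight_add_le (r s : ℤ × ℤ) : expWeight (r + s) ≤ expWeight r * expWeight s := by
  unfold expWeight
  rw [← pow_add]
  refine pow_le_pow_right₀ (by norm_num) ?_
  have h1 := Int.natAbs_add_le r.1 s.1
  have h2 := Int.natAbs_add_le r.2 s.2
  simp only [Prod.fst_add, Prod.snd_add]
  omega

/-- The Banach space of double Fourier series whose coefficients `a` satisfy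
`∑ 2 ^ (|n| + |k|) ‖a (n, k)‖ < ∞`. It is encoded as `ℓ¹`, an element storing the weighted
coefficients `2 ^ (|n| + |k|) a (n, k)`; the coefficients themselves are `coef`. -/
abbrev Wiener := lp (fun _ : ℤ × ℤ => ℂ) 1

/-- The Fourier coefficients of an element of `Wiener`. -/
def coef (b : Wiener) (q : ℤ × ℤ) : ℂ := b q / expWeight q

theorem expWeight_mul_norm_coef (b : Wiener) (q : ℤ × ℤ) :
    expWeight q * ‖coef b q‖ = ‖b q‖ := by
  have := expWeight_pos q
  rw [coef, norm_div, Complex.norm_real, Real.norm_of_nonneg this.le]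
  field_simp

theorem hasSum_norm_coef (b : Wiener) :
    HasSum (fun q => expWeight q * ‖coef b q‖) ‖b‖ := by
  simp_rw [expWeight_mul_norm_coef]
  simpa using lp.hasSum_norm (p := 1) (by simp) b

theorem coef_add (b c : Wiener) (q : ℤ × ℤ) : coef (b + c) q = coef b q + coef c q := by
  simp [coef, add_div]

theorem coef_sub (b c : Wiener) (q : ℤ × ℤ) : coef (b - c) q = coef b q - coef c q := by
  simp [coef, sub_div]

theorem coef_smul (z : ℂ) (b : Wiener) (q : ℤ × ℤ) : coef (z • b) q = z * coef b q := by
  simp [coef, mul_div_assoc]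

theorem coef_real_smul (z : ℝ) (b : Wiener) (q : ℤ × ℤ) : coef (z • b) q = z * coef b q := by
  simp [coef, mul_div_assoc]

theorem coef_zero (q : ℤ × ℤ) : coef 0 q = 0 := by simp [coef]

theorem norm_coef_le (b : Wiener) (q : ℤ × ℤ) : ‖coef b q‖ ≤ ‖b‖ := by
  have h1 := one_le_expWeight q
  have h2 := expWeight_mul_norm_coef b q
  have h3 := lp.norm_apply_le_norm (p := 1) one_ne_zero b q
  nlinarith [norm_nonneg (coef b q)]

/-- The element of `Wiener` with prescribed coefficients. -/
def ofCoef (a : ℤ × ℤ → ℂ) (h : Summable fun q => expWeight q * ‖a q‖) : Wiener :=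
  ⟨fun q => expWeight q * a q, memℓp_gen (by
    simpa [abs_of_pos (expWeight_pos _)] using h)⟩

theorem coef_ofCoef (a : ℤ × ℤ → ℂ) (h : Summable fun q => expWeight q * ‖a q‖) (q : ℤ × ℤ) :
    coef (ofCoef a h) q = a q := by
  have : (expWeight q : ℂ) ≠ 0 := by exact_mod_cast (expWeight_pos q).ne'
  change (expWeight q * a q : ℂ) / expWeight q = a q
  field_simp

theorem wiener_ext {b c : Wiener} (h : ∀ q, coef b q = coef c q) : b = c := by
  refine lp.ext (funext fun q => ?_)
  have : (expWeight q : ℂ) ≠ 0 := by exact_mod_cast (expWeight_pos q).ne'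
  have := h q
  unfold coef at this
  field_simp at this
  exact this

/-- The exponential `e^{i(nt+kx)}`, with `q = (n, k)`. -/
def monomialW (q : ℤ × ℤ) : Wiener := lp.single 1 q (expWeight q : ℂ)

theorem coef_monomialW (q r : ℤ × ℤ) : coef (monomialW q) r = if r = q then 1 else 0 := by
  have : (expWeight q : ℂ) ≠ 0 := by exact_mod_cast (expWeight_pos q).ne'
  unfold coef monomialW
  split_ifs with h
  · subst h
    rw [lp.single_apply_self]
    field_simp
  · rw [lp.single_apply_ne _ _ _ h, zero_div]

theorem norm_monomialW (q : ℤ × ℤ) : ‖monomialW q‖ = expWeight q := by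
  rw [monomialW, lp.norm_single (by simp), Complex.norm_real,
    Real.norm_of_nonneg (expWeight_pos q).le]

/-! ### Linear functionals and multipliers -/

theorem summable_coef_mul (b : Wiener) {φ : ℤ × ℤ → ℂ} (hφ : ∀ q, ‖φ q‖ ≤ expWeight q) :
    Summable fun q => coef b q * φ q := by
  refine Summable.of_norm_bounded (hasSum_norm_coef b).summable fun q => ?_
  rw [norm_mul, mul_comm]
  gcongr
  exact hφ q

/-- The functional `b ↦ ∑ coef b q * φ q`. -/
def pairing (φ : ℤ × ℤ → ℂ) (hφ : ∀ q, ‖φ q‖ ≤ expWeight q) : Wiener →L[ℂ] ℂ :=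
  LinearMap.mkContinuous
    { toFun := fun b => ∑' q, coef b q * φ q
      map_add' := fun b c => by
        simp_rw [coef_add, add_mul]
        exact (summable_coef_mul b hφ).tsum_add (summable_coef_mul c hφ)
      map_smul' := fun z b => by
        simp_rw [coef_smul, mul_assoc, tsum_mul_left]
        rfl } 1 (fun b => by
      rw [one_mul]
      refine tsum_of_norm_bounded (hasSum_norm_coef b) fun q => ?_
      rw [norm_mul, mul_comm]
      gcongr
      exact hφ q)

theorem pairing_apply (φ : ℤ × ℤ → ℂ) (hφ : ∀ q, ‖φ q‖ ≤ expWeight q) (b : Wiener) :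
    pairing φ hφ b = ∑' q, coef b q * φ q := rfl

theorem pairing_monomialW (φ : ℤ × ℤ → ℂ) (hφ : ∀ q, ‖φ q‖ ≤ expWeight q) (q : ℤ × ℤ) :
    pairing φ hφ (monomialW q) = φ q := by
  rw [pairing_apply, tsum_eq_single q]
  · simp [coef_monomialW]
  · intro r hr
    simp [coef_monomialW, hr]

/-- The functional `b ↦ coef b q`. -/
def coefCLM (q : ℤ × ℤ) : Wiener →L[ℂ] ℂ :=
  pairing (fun r => if r = q then 1 else 0) (fun r => by
    have := one_le_expWeight r
    split_ifs
    · simpa using this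
    · simpa using (expWeight_pos r).le)

theorem coefCLM_apply (q : ℤ × ℤ) (b : Wiener) : coefCLM q b = coef b q := by
  rw [coefCLM, pairing_apply, tsum_eq_single q]
  · simp
  · intro r hr
    simp [hr]

theorem continuous_coef (q : ℤ × ℤ) : Continuous fun b : Wiener => coef b q := by
  have h : (fun b : Wiener => coef b q) = coefCLM q := funext fun b => (coefCLM_apply q b).symm
  rw [h]
  exact (coefCLM q).continuous

theorem summable_multiplier {g : ℤ × ℤ → ℂ} {B : ℝ} (hg : ∀ q, ‖g q‖ ≤ B) (b : Wiener) :
    Summable fun q => expWeight q * ‖g q * coef b q‖ := by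
  refine Summable.of_nonneg_of_le (fun q => mul_nonneg (expWeight_pos q).le (norm_nonneg _))
    (fun q => ?_) ((hasSum_norm_coef b).summable.mul_left B)
  rw [norm_mul, mul_left_comm]
  gcongr
  · exact mul_nonneg (expWeight_pos q).le (norm_nonneg _)
  · exact hg q

/-- The Fourier multiplier with bounded symbol `g`. -/
def multiplier (g : ℤ × ℤ → ℂ) (B : ℝ) (hg : ∀ q, ‖g q‖ ≤ B) (b : Wiener) : Wiener :=
  ofCoef (fun q => g q * coef b q) (summable_multiplier hg b)

theorem coef_multiplier (g : ℤ × ℤ → ℂ) (B : ℝ) (hg : ∀ q, ‖g q‖ ≤ B) (b : Wiener)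
    (q : ℤ × ℤ) : coef (multiplier g B hg b) q = g q * coef b q :=
  coef_ofCoef _ _ _

theorem norm_multiplier_le_of_support (g : ℤ × ℤ → ℂ) (B : ℝ) (hg : ∀ q, ‖g q‖ ≤ B) (b : Wiener)
    {B' : ℝ} (h : ∀ q, coef b q ≠ 0 → ‖g q‖ ≤ B') :
    ‖multiplier g B hg b‖ ≤ B' * ‖b‖ := by
  refine hasSum_le (fun q => ?_) (hasSum_norm_coef _) ((hasSum_norm_coef b).mul_left B')
  rw [coef_multiplier, norm_mul, mul_left_comm]
  by_cases hb : coef b q = 0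
  · simp [hb]
  · gcongr
    · exact mul_nonneg (expWeight_pos q).le (norm_nonneg _)
    · exact h q hb

theorem norm_multiplier_le (g : ℤ × ℤ → ℂ) (B : ℝ) (hg : ∀ q, ‖g q‖ ≤ B) (b : Wiener) :
    ‖multiplier g B hg b‖ ≤ B * ‖b‖ :=
  norm_multiplier_le_of_support g B hg b fun q _ => hg q

theorem multiplier_sub (g : ℤ × ℤ → ℂ) (B : ℝ) (hg : ∀ q, ‖g q‖ ≤ B) (b c : Wiener) :
    multiplier g B hg (b - c) = multiplier g B hg b - multiplier g B hg c := by
  refine wiener_ext fun q => ?_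
  simp only [coef_multiplier, coef_sub]
  ring

/-! ### The convolution product -/

theorem norm_conv_term_le (b c : Wiener) (x : (ℤ × ℤ) × (ℤ × ℤ)) :
    ‖(coef b x.1 * coef c x.2) • monomialW (x.1 + x.2)‖ ≤
      (expWeight x.1 * ‖coef b x.1‖) * (expWeight x.2 * ‖coef c x.2‖) := by
  rw [norm_smul, norm_mul, norm_monomialW]
  calc _ ≤ ‖coef b x.1‖ * ‖coef c x.2‖ * (expWeight x.1 * expWeight x.2) := by
        gcongr; exact expWeight_add_le _ _
    _ = _ := by ring

theorem hasSum_conv_bound (b c : Wiener) :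
    HasSum (fun x : (ℤ × ℤ) × (ℤ × ℤ) =>
      (expWeight x.1 * ‖coef b x.1‖) * (expWeight x.2 * ‖coef c x.2‖)) (‖b‖ * ‖c‖) :=
  (hasSum_norm_coef b).mul (hasSum_norm_coef c) <|
    (hasSum_norm_coef b).summable.mul_of_nonneg (hasSum_norm_coef c).summable
      (fun q => mul_nonneg (expWeight_pos q).le (norm_nonneg _))
      (fun q => mul_nonneg (expWeight_pos q).le (norm_nonneg _))

theorem summable_conv (b c : Wiener) :
    Summable fun x : (ℤ × ℤ) × (ℤ × ℤ) =>
      (coef b x.1 * coef c x.2) • monomialW (x.1 + x.2) :=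
  Summable.of_norm_bounded (hasSum_conv_bound b c).summable (norm_conv_term_le b c)

/-- The convolution product of coefficients, that is, the pointwise product of functions. -/
def conv (b c : Wiener) : Wiener :=
  ∑' x : (ℤ × ℤ) × (ℤ × ℤ), (coef b x.1 * coef c x.2) • monomialW (x.1 + x.2)

theorem norm_conv_le (b c : Wiener) : ‖conv b c‖ ≤ ‖b‖ * ‖c‖ :=
  tsum_of_norm_bounded (hasSum_conv_bound b c) (norm_conv_term_le b c)

theorem conv_sub_left (b b' c : Wiener) : conv (b - b') c = conv b c - conv b' c := by
  simp only [conv, coef_sub, sub_mul, sub_smul]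
  exact (summable_conv b c).tsum_sub (summable_conv b' c)

theorem conv_sub_right (b c c' : Wiener) : conv b (c - c') = conv b c - conv b c' := by
  simp only [conv, coef_sub, mul_sub, sub_smul]
  exact (summable_conv b c).tsum_sub (summable_conv b c')

theorem pairing_conv (φ : ℤ × ℤ → ℂ) (hφ : ∀ q, ‖φ q‖ ≤ expWeight q) (b c : Wiener) :
    pairing φ hφ (conv b c) =
      ∑' x : (ℤ × ℤ) × (ℤ × ℤ), coef b x.1 * coef c x.2 * φ (x.1 + x.2) := by
  rw [conv, (pairing φ hφ).map_tsum (summable_conv b c)]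
  simp [pairing_monomialW]

theorem coef_conv (b c : Wiener) (q : ℤ × ℤ) :
    coef (conv b c) q =
      ∑' x : (ℤ × ℤ) × (ℤ × ℤ), coef b x.1 * coef c x.2 * if x.1 + x.2 = q then 1 else 0 := by
  rw [← coefCLM_apply, coefCLM, pairing_conv]

/-- Powers for the convolution product. -/
def convPow (b : Wiener) : ℕ → Wiener
  | 0 => monomialW 0
  | j + 1 => conv b (convPow b j)

theorem norm_convPow_le (b : Wiener) (j : ℕ) : ‖convPow b j‖ ≤ ‖b‖ ^ j := by
  induction j with
  | zero => simp [convPow, norm_monomialW, expWeight]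
  | succ j ih =>
    rw [pow_succ']
    exact (norm_conv_le _ _).trans (by gcongr)

theorem exists_convPow_lipschitz (R : ℝ) (j : ℕ) :
    ∃ K : ℝ, 0 ≤ K ∧ ∀ b c : Wiener, ‖b‖ ≤ R → ‖c‖ ≤ R →
      ‖convPow b j - convPow c j‖ ≤ K * ‖b - c‖ := by
  induction j with
  | zero => exact ⟨0, le_rfl, fun b c _ _ => by simp [convPow]⟩
  | succ j ih =>
    obtain ⟨K, hK, h⟩ := ih
    refine ⟨|R| * K + |R| ^ j, by positivity, fun b c hb hc => ?_⟩
    have e : convPow b (j + 1) - convPow c (j + 1) =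
        conv b (convPow b j - convPow c j) + conv (b - c) (convPow c j) := by
      rw [conv_sub_right, conv_sub_left, convPow, convPow]
      abel
    have hb' := hb.trans (le_abs_self R)
    have hc' := hc.trans (le_abs_self R)
    rw [e]
    calc _ ≤ ‖b‖ * ‖convPow b j - convPow c j‖ + ‖b - c‖ * ‖convPow c j‖ :=
          (norm_add_le _ _).trans (add_le_add (norm_conv_le _ _) (norm_conv_le _ _))
      _ ≤ |R| * (K * ‖b - c‖) + ‖b - c‖ * |R| ^ j := by
          gcongr
          · exact h b c hb hc
          · exact (norm_convPow_le c j).trans (by gcongr)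
      _ = _ := by ring

/-! ### Symmetries of the coefficients -/

/-- The symmetry `φ (a (π q)) = η χ(q) a(q)` of a family of coefficients. It expresses that a
function is real, or odd in `x`, or changes its sign under `t ↦ t + π`, according to the choice of
the automorphism `π` of `ℤ²`, of `φ` (the identity or the conjugation), of the character `χ` and
of the sign `η`. -/
def HasSymmetry (φ : ℂ →+* ℂ) (π : ℤ × ℤ ≃+ ℤ × ℤ) (χ : ℤ × ℤ → ℂ) (η : ℂ) (a : ℤ × ℤ → ℂ) :
    Prop :=
  ∀ q, φ (a (π q)) = η * χ q * a q

theorem HasSymmetry.conv {φ : ℂ →+* ℂ} (hφ : Continuous φ) {π : ℤ × ℤ ≃+ ℤ × ℤ}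
    {χ : ℤ × ℤ → ℂ} (hχ : ∀ r s, χ (r + s) = χ r * χ s) {η η' : ℂ} {b c : Wiener}
    (hb : HasSymmetry φ π χ η (coef b)) (hc : HasSymmetry φ π χ η' (coef c)) :
    HasSymmetry φ π χ (η * η') (coef (conv b c)) := by
  intro q
  have hs : ∀ q', Summable fun x : (ℤ × ℤ) × (ℤ × ℤ) =>
      coef b x.1 * coef c x.2 * if x.1 + x.2 = q' then (1 : ℂ) else 0 := fun q' => by
    have := (coefCLM q').summable (summable_conv b c)
    simpa [coefCLM_apply, coef_smul, coef_monomialW, eq_comm] using this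
  rw [coef_conv, coef_conv, (hs _).map_tsum φ hφ, ← tsum_mul_left,
    ← (Equiv.prodCongr π.toEquiv π.toEquiv).tsum_eq]
  refine tsum_congr fun x => ?_
  have h1 := hb x.1
  have h2 := hc x.2
  simp only [Equiv.prodCongr_apply, Prod.map_fst, Prod.map_snd, map_mul]
  have e : (π x.1 + π x.2 = π q) ↔ x.1 + x.2 = q := by
    rw [← map_add, π.injective.eq_iff]
  change φ (coef b (π x.1)) * φ (coef c (π x.2)) * φ (if π x.1 + π x.2 = π q then 1 else 0) = _
  rw [h1, h2]
  by_cases h : x.1 + x.2 = q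
  · rw [if_pos (e.2 h), if_pos h, ← h, hχ]
    simp only [map_one]
    ring
  · rw [if_neg (fun h' => h (e.1 h')), if_neg h]
    simp

theorem HasSymmetry.convPow {φ : ℂ →+* ℂ} (hφ : Continuous φ) {π : ℤ × ℤ ≃+ ℤ × ℤ}
    {χ : ℤ × ℤ → ℂ} (hχ : ∀ r s, χ (r + s) = χ r * χ s) (hχ0 : χ 0 = 1) {η : ℂ} {b : Wiener}
    (hb : HasSymmetry φ π χ η (coef b)) (j : ℕ) :
    HasSymmetry φ π χ (η ^ j) (coef (convPow b j)) := by
  induction j with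
  | zero =>
    intro q
    rw [_root_.convPow, coef_monomialW, coef_monomialW]
    by_cases h : q = 0
    · simp [h, hχ0]
    · simp [h]
  | succ j ih =>
    rw [pow_succ']
    exact hb.conv hφ hχ ih

/-! ### Small divisors -/

/-- The indices off the kernel `|n| = |k| = 1`, with `n ≠ 0` and `k ≠ 0`. (The coefficients with
`n = 0` or `k = 0` vanish by symmetry for the functions considered.) -/
def IsNonresonant (q : ℤ × ℤ) : Prop :=
  q.1 ≠ 0 ∧ q.2 ≠ 0 ∧ ¬(q.1.natAbs = 1 ∧ q.2.natAbs = 1)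

/-- The symbol of the undamped linear operator at the unperturbed frequency `ω² = 1 + m`. -/
def undampedSymbol (m : ℝ) (q : ℤ × ℤ) : ℝ :=
  (q.2 : ℝ) ^ 2 + m - (1 + m) * (q.1 : ℝ) ^ 2

/-- The symbol of the linear operator at the unperturbed frequency, when the damping times the
frequency is `ε g`. -/
def dampedSymbol (m g ε : ℝ) (q : ℤ × ℤ) : ℂ :=
  ⟨undampedSymbol m q, ε * g * (q.1 * (q.2 : ℝ) ^ 2)⟩

theorem Int.natAbs_eq_one_of_sq {n : ℤ} (h : n ^ 2 = 1) : n.natAbs = 1 := by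
  rw [← Int.natAbs_sq] at h
  have : n.natAbs ^ 2 = 1 := by exact_mod_cast h
  simpa using this

/-- The only place where the irrationality of `m` enters. -/
theorem undampedSymbol_ne_zero {m : ℝ} (hm : Irrational m) {q : ℤ × ℤ} (hq : IsNonresonant q) :
    undampedSymbol m q ≠ 0 := by
  intro h
  obtain ⟨-, -, h1⟩ := hq
  by_cases hn : q.1 ^ 2 = 1
  · have hn' : (q.1 : ℝ) ^ 2 = 1 := by exact_mod_cast hn
    rw [undampedSymbol, hn'] at h
    have hk : (q.2 : ℝ) ^ 2 = 1 := by linarith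
    have hk' : q.2 ^ 2 = 1 := by exact_mod_cast hk
    exact h1 ⟨Int.natAbs_eq_one_of_sq hn, Int.natAbs_eq_one_of_sq hk'⟩
  · have hn' : (q.1 : ℝ) ^ 2 - 1 ≠ 0 := by
      intro h'
      exact hn (by exact_mod_cast sub_eq_zero.1 h')
    refine hm ⟨((q.2 ^ 2 - q.1 ^ 2 : ℤ) : ℚ) / ((q.1 ^ 2 - 1 : ℤ) : ℚ), ?_⟩
    push_cast
    rw [div_eq_iff hn']
    unfold undampedSymbol at h
    linarith

theorem abs_undampedSymbol_le (m g ε : ℝ) (q : ℤ × ℤ) :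
    |undampedSymbol m q| ≤ ‖dampedSymbol m g ε q‖ :=
  Complex.abs_re_le_norm (dampedSymbol m g ε q)

theorem damping_le {g ε : ℝ} (m : ℝ) (hg : 0 < g) (hε : 0 < ε) (q : ℤ × ℤ) :
    ε * g * (|(q.1 : ℝ)| * (q.2 : ℝ) ^ 2) ≤ ‖dampedSymbol m g ε q‖ := by
  refine le_trans (le_of_eq ?_) (Complex.abs_im_le_norm (dampedSymbol m g ε q))
  simp [dampedSymbol, abs_mul, abs_of_pos hg, abs_of_pos hε]

theorem one_le_sq_of_ne_zero {n : ℤ} (h : n ≠ 0) : (1 : ℝ) ≤ (n : ℝ) ^ 2 := by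
  have : 1 ≤ n ^ 2 := by have := sq_pos_of_ne_zero h; omega
  exact_mod_cast this

theorem one_le_abs_of_ne_zero {n : ℤ} (h : n ≠ 0) : (1 : ℝ) ≤ |(n : ℝ)| := by
  exact_mod_cast Int.one_le_abs h

/-- Either the undamped operator is elliptic at `q`, or `q` is close to the characteristic cone, and
then `k` is at least comparable to `n`. -/
theorem elliptic_or_conic {m : ℝ} (hm : 0 < m) {q : ℤ × ℤ} (hq : IsNonresonant q) :
    (q.1 : ℝ) ^ 2 / 2 ≤ |undampedSymbol m q| ∨ (q.1 : ℝ) ^ 2 / 2 ≤ (q.2 : ℝ) ^ 2 := by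
  by_contra! h
  have hk := one_le_sq_of_ne_zero hq.2.1
  have h1 := (neg_le_abs (undampedSymbol m q)).trans_lt h.1
  unfold undampedSymbol at h1
  nlinarith [h.2]

theorem exists_le_undampedSymbol {m : ℝ} (hm : Irrational m) (N : ℝ) :
    ∃ δ > 0, ∀ q : ℤ × ℤ, IsNonresonant q → |(q.1 : ℝ)| ≤ N → |(q.2 : ℝ)| ≤ N →
      δ ≤ |undampedSymbol m q| := by
  classical
  let s : Finset (ℤ × ℤ) :=
    (Finset.Icc (-⌈N⌉) ⌈N⌉ ×ˢ Finset.Icc (-⌈N⌉) ⌈N⌉).filter IsNonresonant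
  have mem : ∀ q : ℤ × ℤ, IsNonresonant q → |(q.1 : ℝ)| ≤ N → |(q.2 : ℝ)| ≤ N → q ∈ s := by
    intro q hq h1 h2
    have key : ∀ n : ℤ, |(n : ℝ)| ≤ N → -⌈N⌉ ≤ n ∧ n ≤ ⌈N⌉ := fun n hn => by
      have : (|n| : ℤ) ≤ ⌈N⌉ := by
        have := hn.trans (Int.le_ceil N)
        exact_mod_cast this
      exact abs_le.1 this
    simp only [s, Finset.mem_filter, Finset.mem_product, Finset.mem_Icc]
    exact ⟨⟨key _ h1, key _ h2⟩, hq⟩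
  rcases s.eq_empty_or_nonempty with h | h
  · refine ⟨1, one_pos, fun q hq h1 h2 => ?_⟩
    have := mem q hq h1 h2
    simp [h] at this
  · obtain ⟨q₀, h₀, hmin⟩ := s.exists_min_image (fun q => |undampedSymbol m q|) h
    exact ⟨_, abs_pos.2 (undampedSymbol_ne_zero hm (Finset.mem_filter.1 h₀).2),
      fun q hq h1 h2 => hmin q (mem q hq h1 h2)⟩

/-- Two time derivatives cost at most a factor `1 / ε`. -/
theorem sq_le_dampedSymbol {m g ε : ℝ} (hm : 0 < m) (hg : 0 < g) (hε : 0 < ε) (hε1 : ε ≤ 1)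
    {q : ℤ × ℤ} (hq : IsNonresonant q) :
    ε * (q.1 : ℝ) ^ 2 ≤ (2 + 2 / g) * ‖dampedSymbol m g ε q‖ := by
  have hn := one_le_abs_of_ne_zero hq.1
  have hn2 := one_le_sq_of_ne_zero hq.1
  have hL := norm_nonneg (dampedSymbol m g ε q)
  have hL' : 0 ≤ 2 / g * ‖dampedSymbol m g ε q‖ := by positivity
  rcases elliptic_or_conic hm hq with h | h
  · have h1 := abs_undampedSymbol_le m g ε q
    nlinarith
  · have h1 := damping_le m hg hε q
    have h2 : ε * g * ((q.1 : ℝ) ^ 2 / 2) ≤ ‖dampedSymbol m g ε q‖ := by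
      refine le_trans ?_ h1
      gcongr
      nlinarith [sq_nonneg (q.2 : ℝ)]
    have h3 : ε * (q.1 : ℝ) ^ 2 ≤ 2 / g * ‖dampedSymbol m g ε q‖ := by
      calc ε * (q.1 : ℝ) ^ 2 = 2 / g * (ε * g * ((q.1 : ℝ) ^ 2 / 2)) := by field_simp
        _ ≤ _ := by gcongr
    nlinarith

/-- One time derivative costs as little as desired: close to the characteristic cone, the damping
gains the large factor `k ^ 2` except at finitely many indices, where the undamped symbol is bounded
away from zero. -/
theorem exists_forall_abs_le_dampedSymbol {m g θ : ℝ} (hm : 0 < m) (hirr : Irrational m)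
    (hg : 0 < g) (hθ : 0 < θ) :
    ∃ ε₀ > 0, ∀ ε, 0 < ε → ε ≤ ε₀ → ∀ q : ℤ × ℤ, IsNonresonant q →
      ε * |(q.1 : ℝ)| ≤ θ * ‖dampedSymbol m g ε q‖ := by
  set N : ℝ := 1 + 2 / (g * θ) with hN
  have hN1 : 1 ≤ N := by rw [hN]; have : 0 < 2 / (g * θ) := by positivity
                         linarith
  obtain ⟨δ, hδ, hδN⟩ := exists_le_undampedSymbol hirr N
  refine ⟨min (θ / 2) (θ * δ / N), by positivity, fun ε hε hε0 q hq => ?_⟩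
  have hε1 : ε ≤ θ / 2 := hε0.trans (min_le_left _ _)
  have hε2 : ε * N ≤ θ * δ := by
    rw [← le_div_iff₀ (by positivity)]
    exact hε0.trans (min_le_right _ _)
  have hn := one_le_abs_of_ne_zero hq.1
  have hk := one_le_abs_of_ne_zero hq.2.1
  have hL1 := abs_undampedSymbol_le m g ε q
  have hL2 := damping_le m hg hε q
  have hn2 : |(q.1 : ℝ)| ^ 2 = (q.1 : ℝ) ^ 2 := sq_abs _
  have hk2 : |(q.2 : ℝ)| ^ 2 = (q.2 : ℝ) ^ 2 := sq_abs _
  rcases elliptic_or_conic hm hq with h | h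
  · have h3 : |(q.1 : ℝ)| / 2 ≤ ‖dampedSymbol m g ε q‖ := by nlinarith
    calc ε * |(q.1 : ℝ)| ≤ θ / 2 * |(q.1 : ℝ)| := by gcongr
      _ = θ * (|(q.1 : ℝ)| / 2) := by ring
      _ ≤ _ := by gcongr
  · by_cases hbig : 1 ≤ θ * (g * (q.2 : ℝ) ^ 2)
    · calc ε * |(q.1 : ℝ)| ≤ ε * |(q.1 : ℝ)| * (θ * (g * (q.2 : ℝ) ^ 2)) :=
            le_mul_of_one_le_right (by positivity) hbig
        _ = θ * (ε * g * (|(q.1 : ℝ)| * (q.2 : ℝ) ^ 2)) := by ring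
        _ ≤ _ := by gcongr
    · have hsmall : (q.2 : ℝ) ^ 2 < 1 / (g * θ) := by
        rw [lt_div_iff₀ (by positivity)]
        linarith [not_le.1 hbig]
      have hT : 2 / (g * θ) = 2 * (1 / (g * θ)) := by ring
      have hkN : |(q.2 : ℝ)| ≤ N := by nlinarith
      have hnN : |(q.1 : ℝ)| ≤ N := by nlinarith
      calc ε * |(q.1 : ℝ)| ≤ ε * N := by gcongr
        _ ≤ θ * δ := hε2
        _ ≤ _ := by
          gcongr
          exact (hδN q hq hnN hkN).trans hL1

/-! ### A contraction principle on closed sets -/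

/-- Banach's fixed point theorem on the intersection of a ball with an invariant closed set, here
the set of coefficients with the symmetries of the problem. -/
theorem exists_fixedPoint_of_contraction {E : Type*} [NormedAddCommGroup E] [CompleteSpace E]
    {S : Set E} (hS : IsClosed S) (h0 : (0 : E) ∈ S) {Φ : E → E} {δ : ℝ}
    (hmaps : ∀ x ∈ S, ‖x‖ ≤ δ → Φ x ∈ S)
    (hlip : ∀ x ∈ S, ∀ y ∈ S, ‖x‖ ≤ δ → ‖y‖ ≤ δ → ‖Φ x - Φ y‖ ≤ 1 / 2 * ‖x - y‖)
    (hδ : ‖Φ 0‖ ≤ δ / 2) :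
    ∃ x ∈ S, ‖x‖ ≤ 2 * ‖Φ 0‖ ∧ Φ x = x := by
  have hδ0 : 0 ≤ δ := by linarith [norm_nonneg (Φ 0)]
  have hM : Set.MapsTo Φ (S ∩ Metric.closedBall 0 δ) (S ∩ Metric.closedBall 0 δ) := by
    rintro x ⟨hx, hxδ⟩
    rw [mem_closedBall_zero_iff] at hxδ
    refine ⟨hmaps x hx hxδ, ?_⟩
    have h1 := hlip x hx 0 h0 hxδ (by simpa using hδ0)
    rw [sub_zero] at h1
    rw [mem_closedBall_zero_iff]
    have h2 := norm_le_norm_sub_add (Φ x) (Φ 0)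
    linarith
  have hC : ContractingWith (1 / 2) (hM.restrict Φ _ _) := by
    refine ⟨one_half_lt_one, LipschitzWith.of_dist_le_mul ?_⟩
    rintro ⟨x, hx, hxδ⟩ ⟨y, hy, hyδ⟩
    rw [mem_closedBall_zero_iff] at hxδ hyδ
    have := hlip x hx y hy hxδ hyδ
    simpa [Subtype.dist_eq, dist_eq_norm] using this
  obtain ⟨x, hx, hfix, -⟩ := hC.exists_fixedPoint' (hS.inter Metric.isClosed_closedBall).isComplete
    hM (x := 0) ⟨h0, by simpa using hδ0⟩ (edist_ne_top _ _)
  have hxδ := mem_closedBall_zero_iff.1 hx.2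
  have hfix : Φ x = x := hfix
  refine ⟨x, hx.1, ?_, hfix⟩
  have h1 := hlip x hx.1 0 h0 hxδ (by simpa using hδ0)
  have h2 := norm_le_norm_sub_add (Φ x) (Φ 0)
  rw [sub_zero] at h1
  rw [hfix] at h1 h2
  linarith

/-! ### The space of admissible coefficients and the leading profile -/

/-- The coefficients of a function that is real, odd in `x`, and changes its sign under
`t ↦ t + π` (so that only odd frequencies in time occur). -/
structure IsAdmissible (a : ℤ × ℤ → ℂ) : Prop where
  conj : ∀ q, (starRingEnd ℂ) (a (-q)) = a q
  odd : ∀ q : ℤ × ℤ, a (q.1, -q.2) = -a q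
  parity : ∀ q : ℤ × ℤ, Even q.1 → a q = 0

/-- The reflection `(n, k) ↦ (n, -k)`. -/
def reflectSnd : ℤ × ℤ ≃+ ℤ × ℤ := (AddEquiv.refl ℤ).prodCongr (AddEquiv.neg ℤ)

theorem reflectSnd_apply (q : ℤ × ℤ) : reflectSnd q = (q.1, -q.2) := rfl

theorem isAdmissible_iff (a : ℤ × ℤ → ℂ) :
    IsAdmissible a ↔ HasSymmetry (starRingEnd ℂ) (AddEquiv.neg (ℤ × ℤ)) 1 1 a ∧
      HasSymmetry (RingHom.id ℂ) reflectSnd 1 (-1) a ∧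
      HasSymmetry (RingHom.id ℂ) (AddEquiv.refl (ℤ × ℤ)) (fun q => (-1) ^ q.1) (-1) a := by
  constructor
  · rintro ⟨h1, h2, h3⟩
    refine ⟨fun q => ?_, fun q => ?_, fun q => ?_⟩
    · simpa using h1 q
    · simpa [reflectSnd_apply] using h2 q
    · rcases Int.even_or_odd q.1 with h | h
      · simp [h3 q h]
      · simp [h.neg_one_zpow]
  · rintro ⟨h1, h2, h3⟩
    refine ⟨fun q => ?_, fun q => ?_, fun q hq => ?_⟩
    · simpa using h1 q
    · simpa [reflectSnd_apply] using h2 q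
    · have := h3 q
      simp only [RingHom.id_apply, AddEquiv.refl_apply, hq.neg_one_zpow] at this
      linear_combination (1 / 2) * this

theorem IsAdmissible.convPow {b : Wiener} (hb : IsAdmissible (coef b)) (p : ℕ) :
    IsAdmissible (coef (convPow b (2 * p + 1))) := by
  rw [isAdmissible_iff] at hb ⊢
  obtain ⟨h1, h2, h3⟩ := hb
  have e : (-1 : ℂ) ^ (2 * p + 1) = -1 := Odd.neg_one_pow ⟨p, rfl⟩
  refine ⟨?_, ?_, ?_⟩
  · simpa using h1.convPow Complex.continuous_conj (by simp) (by simp) (2 * p + 1)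
  · simpa only [e] using h2.convPow continuous_id (by simp) (by simp) (2 * p + 1)
  · simpa only [e] using h3.convPow continuous_id
      (fun r s => by simp [zpow_add₀]) (by simp) (2 * p + 1)

theorem IsAdmissible.add {a b : ℤ × ℤ → ℂ} (ha : IsAdmissible a) (hb : IsAdmissible b) :
    IsAdmissible fun q => a q + b q where
  conj q := by rw [map_add, ha.conj, hb.conj]
  odd q := by rw [ha.odd, hb.odd]; ring
  parity q hq := by rw [ha.parity q hq, hb.parity q hq, add_zero]

/-- Multiplication by a symbol that is even in `k` and that comes from a real operator. -/
theorem IsAdmissible.mul {a g : ℤ × ℤ → ℂ} (ha : IsAdmissible a)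
    (h1 : ∀ q, (starRingEnd ℂ) (g (-q)) = g q) (h2 : ∀ q : ℤ × ℤ, g (q.1, -q.2) = g q) :
    IsAdmissible fun q => g q * a q where
  conj q := by rw [map_mul, ha.conj, h1]
  odd q := by rw [ha.odd, h2]; ring
  parity q hq := by rw [ha.parity q hq, mul_zero]

theorem IsAdmissible.snd_zero {a : ℤ × ℤ → ℂ} (ha : IsAdmissible a) {q : ℤ × ℤ} (hq : q.2 = 0) :
    a q = 0 := by
  have h := ha.odd q
  have e : ((q.1, -q.2) : ℤ × ℤ) = q := Prod.ext rfl (by simp [hq])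
  rw [e] at h
  linear_combination (1 / 2) * h

/-- By symmetry the four kernel coefficients are determined by the one at `(1, 1)`. -/
theorem IsAdmissible.eq_of_kernel {a b : ℤ × ℤ → ℂ} (ha : IsAdmissible a) (hb : IsAdmissible b)
    (h : a (1, 1) = b (1, 1)) {q : ℤ × ℤ} (hq : q.1.natAbs = 1 ∧ q.2.natAbs = 1) : a q = b q := by
  have h2 : a (1, -1) = b (1, -1) := by
    have h3 := ha.odd (1, 1)
    have h4 := hb.odd (1, 1)
    simp only at h3 h4
    rw [h3, h4, h]
  have h3 : a (-1, -1) = b (-1, -1) := by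
    rw [← ha.conj (-1, -1), ← hb.conj (-1, -1)]
    simpa using congrArg (starRingEnd ℂ) h
  have h4 : a (-1, 1) = b (-1, 1) := by
    rw [← ha.conj (-1, 1), ← hb.conj (-1, 1)]
    simpa using congrArg (starRingEnd ℂ) h2
  obtain ⟨n, k⟩ := q
  obtain ⟨hn, hk⟩ := hq
  rcases Int.natAbs_eq n with hn' | hn' <;> rcases Int.natAbs_eq k with hk' | hk' <;>
    · simp only at hn hk
      rw [hn] at hn'
      rw [hk] at hk'
      subst hn' hk'
      simpa

theorem isClosed_isAdmissible : IsClosed {b : Wiener | IsAdmissible (coef b)} := by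
  have e : {b : Wiener | IsAdmissible (coef b)} =
      (⋂ q, {b : Wiener | (starRingEnd ℂ) (coef b (-q)) = coef b q}) ∩
      ((⋂ q : ℤ × ℤ, {b : Wiener | coef b (q.1, -q.2) = -coef b q}) ∩
      (⋂ q : ℤ × ℤ, {b : Wiener | Even q.1 → coef b q = 0})) := by
    ext b
    simp only [Set.mem_inter_iff, Set.mem_iInter, Set.mem_ofPred_eq]
    exact ⟨fun h => ⟨h.1, h.2, h.3⟩, fun h => ⟨h.1, h.2.1, h.2.2⟩⟩
  rw [e]
  refine (isClosed_iInter fun q => isClosed_eq ?_ (continuous_coef q)).inter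
    ((isClosed_iInter fun q => isClosed_eq (continuous_coef _) (continuous_coef q).neg).inter
    (isClosed_iInter fun q => ?_))
  · exact Complex.continuous_conj.comp (continuous_coef _)
  · by_cases h : Even q.1
    · simpa [h] using isClosed_eq (continuous_coef q) continuous_const
    · simp [h]

/-- The coefficients of `-sin t sin x`, the time derivative of `cos t sin x`. -/
def profileCoef (q : ℤ × ℤ) : ℂ :=
  if q.1.natAbs = 1 ∧ q.2.natAbs = 1 then (q.1 * q.2 : ℂ) / 4 else 0

theorem profileCoef_of_not {q : ℤ × ℤ} (h : ¬(q.1.natAbs = 1 ∧ q.2.natAbs = 1)) :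
    profileCoef q = 0 := if_neg h

theorem isAdmissible_profileCoef : IsAdmissible profileCoef where
  conj q := by
    simp only [profileCoef, Prod.fst_neg, Prod.snd_neg, Int.natAbs_neg]
    split_ifs
    · simp [map_ofNat]
    · simp
  odd q := by
    simp only [profileCoef, Int.natAbs_neg]
    split_ifs
    · push_cast; ring
    · simp
  parity q hq := by
    refine if_neg fun h => ?_
    have := h.1
    obtain ⟨r, hr⟩ := hq
    omega

theorem finite_profile_support : {q : ℤ × ℤ | q.1.natAbs = 1 ∧ q.2.natAbs = 1}.Finite := by
  refine ((Set.finite_Icc (-1 : ℤ) 1).prod (Set.finite_Icc (-1 : ℤ) 1)).subset ?_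
  rintro ⟨n, k⟩ ⟨hn, hk⟩
  simp only [Set.mem_prod, Set.mem_Icc] at hn hk ⊢
  omega

theorem summable_profileCoef : Summable fun q => expWeight q * ‖profileCoef q‖ := by
  refine summable_of_hasFiniteSupport (finite_profile_support.subset fun q hq => ?_)
  by_contra h
  refine hq ?_
  change expWeight q * ‖profileCoef q‖ = 0
  rw [profileCoef_of_not h, norm_zero, mul_zero]

/-- The function `-sin t sin x`. -/
def profile : Wiener := ofCoef profileCoef summable_profileCoef

theorem coef_profile (q : ℤ × ℤ) : coef profile q = profileCoef q := coef_ofCoef _ _ _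

theorem coef_profile' : coef profile = profileCoef := funext coef_profile

/-- The powers of `-sin t sin x` are trigonometric polynomials. -/
theorem coef_convPow_profile_support (j : ℕ) (q : ℤ × ℤ) (h : coef (convPow profile j) q ≠ 0) :
    q.1.natAbs ≤ j ∧ q.2.natAbs ≤ j := by
  induction j generalizing q with
  | zero =>
    have : q = 0 := by
      by_contra h0
      exact h (by simp [convPow, coef_monomialW, h0])
    simp [this]
  | succ j ih =>
    by_contra hq
    refine h ?_
    rw [convPow, coef_conv]
    refine (tsum_congr fun x => ?_).trans tsum_zero
    by_cases h1 : coef profile x.1 = 0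
    · simp [h1]
    by_cases h2 : coef (convPow profile j) x.2 = 0
    · simp [h2]
    refine mul_eq_zero_of_right _ (if_neg fun h3 => hq ?_)
    have h4 : x.1.1.natAbs = 1 ∧ x.1.2.natAbs = 1 := by
      by_contra h5
      exact h1 ((coef_profile _).trans (profileCoef_of_not h5))
    have h5 := ih _ h2
    rw [← h3]
    simp only [Prod.fst_add, Prod.snd_add]
    omega

/-- The character by which coefficients are multiplied under `(t, x) ↦ (t + π/2, x + π/2)`. -/
def quarterTurn (q : ℤ × ℤ) : ℂ := Complex.I ^ (q.1 + q.2)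

theorem quarterTurn_add (r s : ℤ × ℤ) : quarterTurn (r + s) = quarterTurn r * quarterTurn s := by
  rw [quarterTurn, quarterTurn, quarterTurn, ← zpow_add₀ Complex.I_ne_zero]
  congr 1
  simp only [Prod.fst_add, Prod.snd_add]
  ring

/-- Convolution preserves nonnegativity of coefficients up to a sign and a character. -/
theorem exists_nonneg_coef_conv {b c : Wiener} {η η' : ℂ} {β γ : ℤ × ℤ → ℝ}
    (hβ : ∀ q, 0 ≤ β q) (hγ : ∀ q, 0 ≤ γ q)
    (hb : ∀ q, quarterTurn q * coef b q = η * β q)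
    (hc : ∀ q, quarterTurn q * coef c q = η' * γ q) (hη : ‖η‖ = 1) (hη' : ‖η'‖ = 1) :
    ∃ d : ℤ × ℤ → ℝ, (∀ q, 0 ≤ d q) ∧ (∀ q, quarterTurn q * coef (conv b c) q = η * η' * d q) ∧
      ∀ r s, β r * γ s ≤ d (r + s) := by
  have hI : ∀ q, ‖quarterTurn q‖ = 1 := fun q => by simp [quarterTurn]
  have hbn : ∀ q, β q = ‖coef b q‖ := fun q => by
    have := congrArg norm (hb q)
    rw [norm_mul, norm_mul, hI, hη, Complex.norm_real, Real.norm_of_nonneg (hβ q)] at this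
    linarith
  have hcn : ∀ q, γ q = ‖coef c q‖ := fun q => by
    have := congrArg norm (hc q)
    rw [norm_mul, norm_mul, hI, hη', Complex.norm_real, Real.norm_of_nonneg (hγ q)] at this
    linarith
  have hnn : ∀ q (x : (ℤ × ℤ) × (ℤ × ℤ)),
      0 ≤ β x.1 * γ x.2 * if x.1 + x.2 = q then (1 : ℝ) else 0 := fun q x => by
    have := hβ x.1
    have := hγ x.2
    split_ifs <;> positivity
  have hs : ∀ q, Summable fun x : (ℤ × ℤ) × (ℤ × ℤ) =>
      β x.1 * γ x.2 * if x.1 + x.2 = q then (1 : ℝ) else 0 := fun q => by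
    refine Summable.of_nonneg_of_le (hnn q) (fun x => ?_) (hasSum_conv_bound b c).summable
    have h1 := hβ x.1
    have h2 := hγ x.2
    have h3 : β x.1 ≤ expWeight x.1 * ‖coef b x.1‖ := by
      rw [← hbn]; exact le_mul_of_one_le_left h1 (one_le_expWeight _)
    have h4 : γ x.2 ≤ expWeight x.2 * ‖coef c x.2‖ := by
      rw [← hcn]; exact le_mul_of_one_le_left h2 (one_le_expWeight _)
    calc _ ≤ β x.1 * γ x.2 := by
          split_ifs
          · rw [mul_one]
          · rw [mul_zero]; positivity
      _ ≤ _ := mul_le_mul h3 h4 h2 (h1.trans h3)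
  refine ⟨fun q => ∑' x : (ℤ × ℤ) × (ℤ × ℤ),
    β x.1 * γ x.2 * if x.1 + x.2 = q then (1 : ℝ) else 0, fun q => tsum_nonneg (hnn q),
    fun q => ?_, fun r s => ?_⟩
  · rw [coef_conv, Complex.ofReal_tsum, ← tsum_mul_left, ← tsum_mul_left]
    refine tsum_congr fun x => ?_
    by_cases h : x.1 + x.2 = q
    · rw [if_pos h, if_pos h, ← h, quarterTurn_add]
      push_cast
      linear_combination (quarterTurn x.2 * coef c x.2) * hb x.1 + η * β x.1 * hc x.2
    · simp [h]
  · have := (hs (r + s)).le_tsum (r, s) (fun x _ => hnn _ x)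
    simpa using this

theorem quarterTurn_mul_profileCoef (q : ℤ × ℤ) :
    quarterTurn q * profileCoef q =
      -1 * ((if q.1.natAbs = 1 ∧ q.2.natAbs = 1 then 1 / 4 else 0 : ℝ) : ℂ) := by
  obtain ⟨n, k⟩ := q
  by_cases h : n.natAbs = 1 ∧ k.natAbs = 1
  · simp only [profileCoef, quarterTurn]
    rw [if_pos h, if_pos h]
    obtain ⟨hn, hk⟩ := h
    have hI : Complex.I ^ (-2 : ℤ) = -1 := by
      rw [zpow_neg]; norm_num [zpow_ofNat]
    have hI' : Complex.I ^ (2 : ℤ) = -1 := by norm_num [zpow_ofNat]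
    rcases Int.natAbs_eq n with hn' | hn' <;> rcases Int.natAbs_eq k with hk' | hk' <;>
      · rw [hn] at hn'
        rw [hk] at hk'
        subst hn' hk'
        norm_num [hI, hI']
  · simp only [profileCoef]
    rw [if_neg h, if_neg h]
    simp

/-- Up to a sign, translating `-sin t sin x` by a quarter of a period gives `cos t cos x`, whose
coefficients, and those of its powers, are nonnegative. -/
theorem exists_nonneg_coef_convPow_profile (j : ℕ) :
    ∃ d : ℤ × ℤ → ℝ, (∀ q, 0 ≤ d q) ∧
      (∀ q, quarterTurn q * coef (convPow profile j) q = (-1) ^ j * d q) ∧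
      (Even j → 0 < d 0) ∧ (Odd j → 0 < d (1, 1)) := by
  induction j with
  | zero =>
    refine ⟨fun q => if q = 0 then 1 else 0, fun q => by positivity, fun q => ?_, fun _ => by simp,
      fun h => by simp at h⟩
    by_cases h : q = 0
    · simp [convPow, coef_monomialW, h, quarterTurn]
    · simp [convPow, coef_monomialW, h]
  | succ j ih =>
    obtain ⟨d, h0, h1, h2, h3⟩ := ih
    obtain ⟨d', h0', h1', h2'⟩ := exists_nonneg_coef_conv (b := profile)
      (β := fun q => if q.1.natAbs = 1 ∧ q.2.natAbs = 1 then 1 / 4 else 0) (η := -1)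
      (fun q => by positivity) h0
      (fun q => by rw [coef_profile]; exact quarterTurn_mul_profileCoef q) h1 (by simp) (by simp)
    refine ⟨d', h0', fun q => ?_, fun h => ?_, fun h => ?_⟩
    · rw [pow_succ']
      exact h1' q
    · have := h2' (-1, -1) (1, 1)
      have h4 := h3 (by rcases Nat.even_or_odd j with h' | h'
                        · exact absurd h (Nat.not_even_iff_odd.2 h'.add_one)
                        · exact h')
      have e : ((-1, -1) + (1, 1) : ℤ × ℤ) = 0 := by simp
      rw [e] at this
      norm_num at this
      linarith
    · have := h2' (1, 1) 0
      have h4 := h2 (by rcases Nat.even_or_odd j with h' | h'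
                        · exact h'
                        · exact absurd h (Nat.not_odd_iff_even.2 h'.add_one))
      rw [add_zero] at this
      norm_num at this
      linarith

theorem exists_coef_convPow_profile (p : ℕ) :
    ∃ a : ℝ, 0 < a ∧ coef (convPow profile (2 * p + 1)) (1, 1) = a := by
  obtain ⟨d, -, h1, -, h3⟩ := exists_nonneg_coef_convPow_profile (2 * p + 1)
  refine ⟨d (1, 1), h3 ⟨p, rfl⟩, ?_⟩
  have h := h1 (1, 1)
  have e : quarterTurn (1, 1) = -1 := by norm_num [quarterTurn, zpow_ofNat]
  rw [e, Odd.neg_one_pow ⟨p, rfl⟩] at h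
  linear_combination -h

/-! ### The nonlinear term -/

theorem exists_sqrt_pow_lipschitz {m : ℝ} (hm : 0 < m) (j : ℕ) :
    ∃ K : ℝ, 0 ≤ K ∧ ∀ σ σ' : ℝ, |σ| ≤ 1 / 2 → |σ'| ≤ 1 / 2 →
      |√(1 + m + σ) ^ j - √(1 + m + σ') ^ j| ≤ K * |σ - σ'| := by
  have h : ContDiffOn ℝ 1 (fun σ : ℝ => √(1 + m + σ) ^ j) (Set.Icc (-(1 / 2)) (1 / 2)) := by
    refine (ContDiffOn.sqrt (by fun_prop) fun σ hσ => ?_).pow j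
    have := hσ.1
    simp only [ne_eq]
    linarith
  obtain ⟨K, hK⟩ := h.exists_lipschitzOnWith one_ne_zero (convex_Icc _ _) isCompact_Icc
  refine ⟨K, K.2, fun σ σ' h1 h2 => ?_⟩
  exact hK.dist_le_mul σ (abs_le.1 h1) σ' (abs_le.1 h2)

/-- The coefficients of `ω ^ (2p+1) (-sin t sin x + Y) ^ (2p+1)` with `ω² = 1 + m + σ`. -/
def forcing (p : ℕ) (m : ℝ) (Y : Wiener) (σ : ℝ) : Wiener :=
  (√(1 + m + σ) ^ (2 * p + 1)) • convPow (profile + Y) (2 * p + 1)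

theorem coef_forcing (p : ℕ) (m : ℝ) (Y : Wiener) (σ : ℝ) (q : ℤ × ℤ) :
    coef (forcing p m Y σ) q =
      (√(1 + m + σ) : ℂ) ^ (2 * p + 1) * coef (convPow (profile + Y) (2 * p + 1)) q := by
  rw [forcing, coef_real_smul]
  push_cast
  rfl

theorem exists_forcing_lipschitz (p : ℕ) {m : ℝ} (hm : 0 < m) :
    ∃ K : ℝ, 0 < K ∧ ∀ (Y Y' : Wiener) (σ σ' : ℝ), ‖Y‖ ≤ 1 → ‖Y'‖ ≤ 1 → |σ| ≤ 1 / 2 →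
      |σ'| ≤ 1 / 2 → ‖forcing p m Y σ - forcing p m Y' σ'‖ ≤ K * (‖Y - Y'‖ + |σ - σ'|) := by
  obtain ⟨K₁, hK₁, h1⟩ := exists_sqrt_pow_lipschitz hm (2 * p + 1)
  obtain ⟨K₂, hK₂, h2⟩ := exists_convPow_lipschitz (‖profile‖ + 1) (2 * p + 1)
  set P := (‖profile‖ + 1) ^ (2 * p + 1)
  set R := √(1 + m + 1 / 2) ^ (2 * p + 1)
  have hP : 0 < P := by positivity
  have hR : 0 < R := by positivity
  have hball : ∀ Y : Wiener, ‖Y‖ ≤ 1 → ‖profile + Y‖ ≤ ‖profile‖ + 1 := fun Y hY =>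
    (norm_add_le _ _).trans (by linarith)
  refine ⟨R * K₂ + K₁ * P + 1, by positivity, fun Y Y' σ σ' hY hY' hσ hσ' => ?_⟩
  have e : forcing p m Y σ - forcing p m Y' σ' =
      (√(1 + m + σ) ^ (2 * p + 1)) •
        (convPow (profile + Y) (2 * p + 1) - convPow (profile + Y') (2 * p + 1)) +
      (√(1 + m + σ) ^ (2 * p + 1) - √(1 + m + σ') ^ (2 * p + 1)) •
        convPow (profile + Y') (2 * p + 1) := by
    rw [forcing, forcing, smul_sub, sub_smul]
    abel
  have h3 : ‖√(1 + m + σ) ^ (2 * p + 1)‖ ≤ R := by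
    rw [Real.norm_of_nonneg (by positivity)]
    exact pow_le_pow_left₀ (Real.sqrt_nonneg _)
      (Real.sqrt_le_sqrt (by linarith [(abs_le.1 hσ).2])) _
  have h4 := h2 _ _ (hball Y hY) (hball Y' hY')
  rw [add_sub_add_left_eq_sub] at h4
  have h5 : ‖convPow (profile + Y') (2 * p + 1)‖ ≤ P :=
    (norm_convPow_le _ _).trans (pow_le_pow_left₀ (norm_nonneg _) (hball Y' hY') _)
  have h6 := h1 σ σ' hσ hσ'
  rw [e]
  calc _ ≤ R * (K₂ * ‖Y - Y'‖) + K₁ * |σ - σ'| * P := by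
        refine (norm_add_le _ _).trans (add_le_add ?_ ?_)
        · rw [norm_smul]; gcongr
        · rw [norm_smul]; gcongr; exact h6
    _ ≤ _ := by
        have := norm_nonneg (Y - Y')
        have := abs_nonneg (σ - σ')
        have h7 : 0 ≤ R * K₂ * |σ - σ'| := by positivity
        have h8 : 0 ≤ K₁ * P * ‖Y - Y'‖ := by positivity
        linarith

theorem isAdmissible_forcing (p : ℕ) (m : ℝ) {Y : Wiener} (hY : IsAdmissible (coef Y)) (σ : ℝ) :
    IsAdmissible (coef (forcing p m Y σ)) := by
  have h1 : IsAdmissible (coef (profile + Y)) := by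
    have h := isAdmissible_profileCoef.add hY
    rwa [show (fun q => profileCoef q + coef Y q) = coef (profile + Y) from
      funext fun q => by rw [coef_add, coef_profile]] at h
  have h2 := (h1.convPow p).mul (g := fun _ => (√(1 + m + σ) : ℂ) ^ (2 * p + 1))
    (fun q => by simp) (fun q => rfl)
  rwa [show (fun q => (√(1 + m + σ) : ℂ) ^ (2 * p + 1) *
    coef (convPow (profile + Y) (2 * p + 1)) q) = coef (forcing p m Y σ) from
      funext fun q => (coef_forcing p m Y σ q).symm] at h2

/-! ### The inverse of the linear operator off the kernel -/

open Classical in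
/-- The symbol `h` divided by the damped symbol on the nonresonant indices, and `0` elsewhere. -/
def truncInverse (m g ε : ℝ) (h : ℤ × ℤ → ℂ) (q : ℤ × ℤ) : ℂ :=
  if IsNonresonant q then h q / dampedSymbol m g ε q else 0

theorem norm_truncInverse_le {m g ε : ℝ} {h : ℤ × ℤ → ℂ} {q : ℤ × ℤ} {B : ℝ} (hB : 0 ≤ B)
    (hle : IsNonresonant q → ‖h q‖ ≤ B * ‖dampedSymbol m g ε q‖) :
    ‖truncInverse m g ε h q‖ ≤ B := by
  unfold truncInverse
  split_ifs with hq
  · rw [norm_div]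
    exact div_le_of_le_mul₀ (norm_nonneg _) hB (hle hq)
  · simpa using hB

theorem isNonresonant_neg (q : ℤ × ℤ) : IsNonresonant (-q) ↔ IsNonresonant q := by
  simp [IsNonresonant]

theorem isNonresonant_reflect (q : ℤ × ℤ) : IsNonresonant (q.1, -q.2) ↔ IsNonresonant q := by
  simp [IsNonresonant]

theorem conj_dampedSymbol (m g ε : ℝ) (q : ℤ × ℤ) :
    (starRingEnd ℂ) (dampedSymbol m g ε (-q)) = dampedSymbol m g ε q := by
  apply Complex.ext <;> simp [dampedSymbol, undampedSymbol]

theorem dampedSymbol_reflect (m g ε : ℝ) (q : ℤ × ℤ) :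
    dampedSymbol m g ε (q.1, -q.2) = dampedSymbol m g ε q := by
  apply Complex.ext <;> simp [dampedSymbol, undampedSymbol]

theorem IsAdmissible.truncInverse {m g ε : ℝ} {h : ℤ × ℤ → ℂ} {B : ℝ}
    (hB : ∀ q, ‖truncInverse m g ε h q‖ ≤ B) {b : Wiener} (hb : IsAdmissible (coef b))
    (h1 : ∀ q, (starRingEnd ℂ) (h (-q)) = h q) (h2 : ∀ q : ℤ × ℤ, h (q.1, -q.2) = h q) :
    IsAdmissible (coef (multiplier (truncInverse m g ε h) B hB b)) := by
  have := hb.mul (g := _root_.truncInverse m g ε h) (fun q => ?_) (fun q => ?_)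
  · rwa [show (fun q => _root_.truncInverse m g ε h q * coef b q) =
      coef (multiplier (_root_.truncInverse m g ε h) B hB b) from
        funext fun q => (coef_multiplier _ _ _ _ _).symm] at this
  · by_cases hq : IsNonresonant q
    · rw [_root_.truncInverse, _root_.truncInverse, if_pos hq, if_pos ((isNonresonant_neg q).2 hq),
        map_div₀, h1, conj_dampedSymbol]
    · rw [_root_.truncInverse, _root_.truncInverse, if_neg hq,
        if_neg (mt (isNonresonant_neg q).1 hq), map_zero]
  · by_cases hq : IsNonresonant q
    · rw [_root_.truncInverse, _root_.truncInverse, if_pos hq,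
        if_pos ((isNonresonant_reflect q).2 hq), h2, dampedSymbol_reflect]
    · rw [_root_.truncInverse, _root_.truncInverse, if_neg hq,
        if_neg (mt (isNonresonant_reflect q).1 hq)]

theorem IsAdmissible.coef_add {b c : Wiener} (hb : IsAdmissible (coef b))
    (hc : IsAdmissible (coef c)) : IsAdmissible (coef (b + c)) := by
  simpa only [← _root_.coef_add] using hb.add hc

theorem IsAdmissible.coef_real_smul {b : Wiener} (hb : IsAdmissible (coef b)) (z : ℝ) :
    IsAdmissible (coef (z • b)) := by
  simpa only [← _root_.coef_real_smul] using
    hb.mul (g := fun _ => (z : ℂ)) (fun q => by simp) (fun q => rfl)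

/-! ### Solution of the equations for the coefficients -/

set_option maxHeartbeats 400000 in
/-- Existence of the coefficients, for `ε = ρ ^ (2p)`, of the correction `Y` to the profile
`-sin t sin x`, together with the parameters: the squared frequency is `1 + m + ε Im z` and damping
times frequency is `ε (g + Re z)`. The last two conclusions are the equation on the kernel modes
and the equation on the nonresonant modes. -/
theorem exists_coefficients (p : ℕ) {m : ℝ} (hm : 0 < m) (hirr : Irrational m) :
    ∃ g C ε₀ : ℝ, 0 < g ∧ 0 < C ∧ 0 < ε₀ ∧ ∀ ε : ℝ, 0 < ε → ε < ε₀ →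
      ∃ (Y : Wiener) (z : ℂ), ‖Y‖ ≤ C * ε ∧ ‖z‖ ≤ C * ε ∧ IsAdmissible (coef Y) ∧
        (∀ q, ¬IsNonresonant q → coef Y q = 0) ∧
        (g + z : ℂ) = 4 * coef (forcing p m Y (ε * z.im)) (1, 1) ∧
        ∀ q : ℤ × ℤ, IsNonresonant q →
          ((q.2 : ℂ) ^ 2 + m - (1 + m + ε * z.im) * (q.1 : ℂ) ^ 2 +
            Complex.I * (ε * (g + z.re) * (q.1 * (q.2 : ℂ) ^ 2))) * coef Y q =
          ε * (Complex.I * q.1) * coef (forcing p m Y (ε * z.im)) q := by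
  obtain ⟨a, ha, haF⟩ := exists_coef_convPow_profile p
  obtain ⟨KH, hKH, hLip⟩ := exists_forcing_lipschitz p hm
  set g : ℝ := 4 * (√(1 + m) ^ (2 * p + 1) * a) with hg_def
  have hg : 0 < g := by positivity
  obtain ⟨δN, hδN, hdiv⟩ := exists_le_undampedSymbol hirr (2 * p + 1)
  have hF0 : (4 : ℂ) * coef (forcing p m 0 0) (1, 1) = g := by
    rw [coef_forcing, add_zero, add_zero, haF, hg_def]
    push_cast
    ring
  -- The parameter `z` is of the size of `K ‖Y‖` only, hence it is measured in units of `K`.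
  set K : ℝ := 16 * KH with hK_def
  have hK : 0 < K := by positivity
  -- With `L` the unperturbed damped symbol, the multiplier `ε ∂_t / L` is made small compared with
  -- the Lipschitz constant of the forcing; the two other multipliers `ε ∂_t² / L` and
  -- `ε ∂_t ∂_x² / L` are merely bounded, but they come with the small factors `z` and `Y`.
  obtain ⟨εA, hεA, hA⟩ := exists_forall_abs_le_dampedSymbol (θ := 1 / (6 * KH)) hm hirr hg
    (by positivity)
  set Cs : ℝ := (2 + 2 / g) + 1 / g with hCs_def
  have hCs : 0 < Cs := by positivity
  set δ : ℝ := min 1 (1 / (8 * K * Cs)) with hδ_def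
  have hδ : 0 < δ := by positivity
  have hδ1 : δ ≤ 1 := min_le_left _ _
  have hδ2 : 2 * K * δ * Cs ≤ 1 / 4 := by
    have : δ ≤ 1 / (8 * K * Cs) := min_le_right _ _
    rw [le_div_iff₀ (by positivity)] at this
    linarith
  set C₀ : ℝ := (2 * p + 1) / δN * ‖forcing p m 0 0‖ with hC0_def
  have hC0 : 0 ≤ C₀ := by positivity
  refine ⟨g, 2 * C₀ * (1 + K) + 1, min (min 1 εA) (min (1 / (2 * K)) (δ / (2 * (C₀ + 1)))), hg,
    by positivity, by positivity, fun ε hε hεlt => ?_⟩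
  have hε1 : ε ≤ 1 := hεlt.le.trans ((min_le_left _ _).trans (min_le_left _ _))
  have hε2 : ε ≤ εA := hεlt.le.trans ((min_le_left _ _).trans (min_le_right _ _))
  have hε3 : ε * K ≤ 1 / 2 := by
    have : ε ≤ 1 / (2 * K) := hεlt.le.trans ((min_le_right _ _).trans (min_le_left _ _))
    rw [le_div_iff₀ (by positivity)] at this
    linarith
  have hε4 : C₀ * ε ≤ δ / 2 := by
    have : ε ≤ δ / (2 * (C₀ + 1)) := hεlt.le.trans ((min_le_right _ _).trans (min_le_right _ _))
    rw [le_div_iff₀ (by positivity)] at this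
    nlinarith
  -- On the nonresonant modes, the changes of the frequency and of the damping are moved to the
  -- right-hand side: with the unperturbed symbol `L` the equation reads
  -- `L Y = ε ∂_t F - ε (Im z) ∂_t² Y + ε (Re z) ∂_t ∂_x² Y`.
  let symA : ℤ × ℤ → ℂ := fun q => ε * (Complex.I * q.1)
  let symB : ℤ × ℤ → ℂ := fun q => ε * (q.1 : ℂ) ^ 2
  let symD : ℤ × ℤ → ℂ := fun q => -(ε * (Complex.I * q.1) * (q.2 : ℂ) ^ 2)
  have nA : ∀ q : ℤ × ℤ, ‖symA q‖ = ε * |(q.1 : ℝ)| := fun q => by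
    simp [symA, abs_of_pos hε, Complex.norm_intCast]
  have bA : ∀ q, ‖truncInverse m g ε symA q‖ ≤ 1 / (6 * KH) := fun q =>
    norm_truncInverse_le (by positivity) fun hq => by
      rw [nA]
      exact hA ε hε hε2 q hq
  have bB : ∀ q, ‖truncInverse m g ε symB q‖ ≤ 2 + 2 / g := fun q =>
    norm_truncInverse_le (by positivity) fun hq => by
      have := sq_le_dampedSymbol hm hg hε hε1 hq
      simpa [symB, abs_of_pos hε, Complex.norm_intCast] using this
  have bD : ∀ q, ‖truncInverse m g ε symD q‖ ≤ 1 / g := fun q =>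
    norm_truncInverse_le (by positivity) fun hq => by
      have := damping_le m hg hε q
      rw [one_div, inv_mul_eq_div, le_div_iff₀ hg]
      simp only [symD, norm_neg, norm_mul, norm_pow, Complex.norm_real, Complex.norm_I,
        Complex.norm_intCast, Real.norm_eq_abs, abs_of_pos hε, sq_abs]
      linarith
  let MA := multiplier (truncInverse m g ε symA) _ bA
  let MB := multiplier (truncInverse m g ε symB) _ bB
  let MD := multiplier (truncInverse m g ε symD) _ bD
  let G : Wiener × ℂ → Wiener := fun X => forcing p m X.1 (ε * (K * X.2.im))
  let Φ : Wiener × ℂ → Wiener × ℂ := fun X =>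
    (MA (G X) + ((K * X.2.im) • MB X.1 + (K * X.2.re) • MD X.1),
      (4 * coef (G X) (1, 1) - g) / K)
  have hG : ∀ X X' : Wiener × ℂ, ‖X‖ ≤ δ → ‖X'‖ ≤ δ → ‖G X - G X'‖ ≤ KH * (3 / 2 * ‖X - X'‖) := by
    intro X X' hX hX'
    have him : ∀ X : Wiener × ℂ, ‖X‖ ≤ δ → |ε * (K * X.2.im)| ≤ 1 / 2 := fun X hX => by
      have h1 : |X.2.im| ≤ 1 :=
        (Complex.abs_im_le_norm _).trans ((norm_snd_le X).trans (hX.trans hδ1))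
      rw [← mul_assoc, abs_mul, abs_of_pos (by positivity : 0 < ε * K)]
      nlinarith [abs_nonneg X.2.im]
    refine (hLip _ _ _ _ ((norm_fst_le X).trans (hX.trans hδ1))
      ((norm_fst_le X').trans (hX'.trans hδ1)) (him X hX) (him X' hX')).trans ?_
    have h1 : ‖X.1 - X'.1‖ ≤ ‖X - X'‖ := norm_fst_le (X - X')
    have h2 : |X.2.im - X'.2.im| ≤ ‖X - X'‖ :=
      (Complex.abs_im_le_norm (X.2 - X'.2)).trans (norm_snd_le (X - X'))
    have h3 : |ε * (K * X.2.im) - ε * (K * X'.2.im)| ≤ 1 / 2 * ‖X - X'‖ := by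
      have e : ε * (K * X.2.im) - ε * (K * X'.2.im) = ε * K * (X.2.im - X'.2.im) := by ring
      rw [e, abs_mul, abs_of_pos (by positivity : 0 < ε * K)]
      gcongr
    gcongr
    linarith
  have hbil : ∀ (M : Wiener → Wiener) (B : ℝ), (∀ b c, M (b - c) = M b - M c) →
      (∀ b, ‖M b‖ ≤ B * ‖b‖) → 0 ≤ B → ∀ (b c : Wiener) (s s' D : ℝ), ‖c‖ ≤ δ → |s| ≤ δ →
      ‖b - c‖ ≤ D → |s - s'| ≤ D →
      ‖(K * s) • M b - (K * s') • M c‖ ≤ 2 * K * δ * B * D := by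
    intro M B hM hMB hB b c s s' D hc hs hbc hss
    have e : (K * s) • M b - (K * s') • M c = (K * s) • M (b - c) + (K * (s - s')) • M c := by
      rw [hM, smul_sub, mul_sub, sub_smul]
      abel
    rw [e]
    calc _ ≤ K * |s| * (B * ‖b - c‖) + K * |s - s'| * (B * ‖c‖) := by
          refine (norm_add_le _ _).trans (add_le_add ?_ ?_) <;>
          · rw [norm_smul, Real.norm_eq_abs, abs_mul, abs_of_pos hK]
            gcongr
            exact hMB _
      _ ≤ K * δ * (B * D) + K * D * (B * δ) := by
          have := (norm_nonneg _).trans hbc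
          gcongr
      _ = _ := by ring
  have hΦlip : ∀ X X' : Wiener × ℂ, ‖X‖ ≤ δ → ‖X'‖ ≤ δ →
      ‖Φ X - Φ X'‖ ≤ 1 / 2 * ‖X - X'‖ := by
    intro X X' hX hX'
    have hGX := hG X X' hX hX'
    have h1 : ‖X.1 - X'.1‖ ≤ ‖X - X'‖ := norm_fst_le (X - X')
    have h2 : |X.2.im - X'.2.im| ≤ ‖X - X'‖ :=
      (Complex.abs_im_le_norm (X.2 - X'.2)).trans (norm_snd_le (X - X'))
    have h3 : |X.2.re - X'.2.re| ≤ ‖X - X'‖ :=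
      (Complex.abs_re_le_norm (X.2 - X'.2)).trans (norm_snd_le (X - X'))
    have h4 : |X.2.im| ≤ δ := (Complex.abs_im_le_norm _).trans ((norm_snd_le X).trans hX)
    have h5 : |X.2.re| ≤ δ := (Complex.abs_re_le_norm _).trans ((norm_snd_le X).trans hX)
    have h6 := (norm_fst_le X').trans hX'
    -- The norm of `Wiener × ℂ` is the maximum of the two norms.
    refine norm_prod_le_iff.2 ⟨?_, ?_⟩
    · have i1 : ‖MA (G X) - MA (G X')‖ ≤ 1 / 4 * ‖X - X'‖ := by
        rw [← multiplier_sub]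
        refine (norm_multiplier_le _ _ _ _).trans ?_
        calc _ ≤ 1 / (6 * KH) * (KH * (3 / 2 * ‖X - X'‖)) := by gcongr
          _ = _ := by field_simp; ring
      have i2 := hbil MB _ (multiplier_sub _ _ bB) (norm_multiplier_le _ _ bB) (by positivity)
        X.1 X'.1 X.2.im X'.2.im _ h6 h4 h1 h2
      have i3 := hbil MD _ (multiplier_sub _ _ bD) (norm_multiplier_le _ _ bD) (by positivity)
        X.1 X'.1 X.2.re X'.2.re _ h6 h5 h1 h3
      have e : (Φ X - Φ X').1 = (MA (G X) - MA (G X')) +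
          (((K * X.2.im) • MB X.1 - (K * X'.2.im) • MB X'.1) +
            ((K * X.2.re) • MD X.1 - (K * X'.2.re) • MD X'.1)) := by
        simp only [Φ, Prod.fst_sub]
        abel
      rw [e]
      have i4 := (norm_add_le (MA (G X) - MA (G X'))
          (((K * X.2.im) • MB X.1 - (K * X'.2.im) • MB X'.1) +
            ((K * X.2.re) • MD X.1 - (K * X'.2.re) • MD X'.1))).trans
        (add_le_add_right (norm_add_le _ _) _)
      have i5 : 2 * K * δ * (2 + 2 / g) * ‖X - X'‖ + 2 * K * δ * (1 / g) * ‖X - X'‖ ≤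
          1 / 4 * ‖X - X'‖ := by
        rw [← add_mul, ← mul_add]
        gcongr
      linarith
    · have e : (Φ X - Φ X').2 = 4 / K * coef (G X - G X') (1, 1) := by
        simp only [Φ, Prod.snd_sub, coef_sub]
        ring
      rw [e, norm_mul, norm_div, Complex.norm_real, Real.norm_of_nonneg hK.le]
      calc _ ≤ ‖(4 : ℂ)‖ / K * (KH * (3 / 2 * ‖X - X'‖)) := by
            gcongr
            exact (norm_coef_le _ _).trans hGX
        _ = 3 / 8 * ‖X - X'‖ := by
            rw [hK_def]
            norm_num
            field_simp
            ring
        _ ≤ _ := by linarith [norm_nonneg (X - X')]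
  have hG0 : G 0 = forcing p m 0 0 := by simp [G]
  -- At `0` the forcing is a trigonometric polynomial, on whose frequencies the divisors are bounded
  -- below uniformly in `ε`.
  have hΦ0 : ‖Φ 0‖ ≤ C₀ * ε := by
    refine norm_prod_le_iff.2 ⟨?_, ?_⟩
    · have e : (Φ 0).1 = MA (forcing p m 0 0) := by simp [Φ, hG0]
      rw [e]
      refine (norm_multiplier_le_of_support _ _ _ _ (B' := (2 * p + 1) / δN * ε)
        fun q hq => ?_).trans (by rw [hC0_def]; exact le_of_eq (by ring))
      have hq' : coef (convPow profile (2 * p + 1)) q ≠ 0 := by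
        intro h0
        rw [coef_forcing, add_zero, add_zero, h0, mul_zero] at hq
        exact hq rfl
      obtain ⟨hn, hk⟩ := coef_convPow_profile_support _ _ hq'
      have cast : ∀ n : ℤ, n.natAbs ≤ 2 * p + 1 → |(n : ℝ)| ≤ 2 * p + 1 := fun n h => by
        rw [← Int.cast_abs, Int.abs_eq_natAbs]
        exact_mod_cast h
      refine norm_truncInverse_le (by positivity) fun hqn => ?_
      rw [nA]
      have i1 := hdiv q hqn (cast _ hn) (cast _ hk)
      have i2 := i1.trans (abs_undampedSymbol_le m g ε q)
      calc ε * |(q.1 : ℝ)| ≤ ε * (2 * p + 1) := by gcongr; exact cast _ hn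
        _ = (2 * p + 1) / δN * ε * δN := by field_simp
        _ ≤ _ := by gcongr
    · have e : (Φ 0).2 = 0 := by simp [Φ, hG0, hF0]
      rw [e, norm_zero]
      positivity
  obtain ⟨X, hXS, hXn, hfix⟩ := exists_fixedPoint_of_contraction
    (S := {X : Wiener × ℂ | IsAdmissible (coef X.1)}) (δ := δ) (Φ := Φ)
    (isClosed_isAdmissible.preimage continuous_fst)
    ⟨fun q => by simp [coef_zero], fun q => by simp [coef_zero], fun q _ => by simp [coef_zero]⟩
    (fun X hX _ => by
      refine IsAdmissible.coef_add ?_ (IsAdmissible.coef_add ?_ ?_)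
      · exact (isAdmissible_forcing p m hX _).truncInverse bA (fun q => by simp [symA])
          (fun q => rfl)
      · exact ((show IsAdmissible (coef X.1) from hX).truncInverse bB (fun q => by simp [symB])
          (fun q => rfl)).coef_real_smul _
      · exact ((show IsAdmissible (coef X.1) from hX).truncInverse bD (fun q => by simp [symD])
          (fun q => by simp [symD])).coef_real_smul _)
    (fun X _ X' _ hX hX' => hΦlip X X' hX hX') (hΦ0.trans hε4)
  have hXn' : ‖X‖ ≤ 2 * C₀ * ε := by linarith
  have hz : (K * X.2 : ℂ).im = K * X.2.im ∧ (K * X.2 : ℂ).re = K * X.2.re := by simp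
  have hY : ∀ q, coef X.1 q = truncInverse m g ε symA q * coef (G X) q +
      (K * X.2.im * (truncInverse m g ε symB q * coef X.1 q) +
        K * X.2.re * (truncInverse m g ε symD q * coef X.1 q)) := fun q => by
    conv_lhs => rw [← hfix]
    simp only [Φ, MA, MB, MD, coef_add, coef_real_smul, coef_multiplier]
    push_cast
    rfl
  refine ⟨X.1, K * X.2, ?_, ?_, hXS, fun q hq => ?_, ?_, fun q hq => ?_⟩
  · have := norm_fst_le X
    linarith [mul_nonneg (mul_nonneg hC0 hε.le) hK.le]
  · have := norm_snd_le X
    rw [norm_mul, Complex.norm_real, Real.norm_of_nonneg hK.le]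
    calc K * ‖X.2‖ ≤ K * (2 * C₀ * ε) := by gcongr; linarith
      _ ≤ _ := by linarith [mul_nonneg hC0 hε.le]
  · rw [hY q]
    simp [truncInverse, hq]
  · have h2 : (4 * coef (G X) (1, 1) - g) / K = X.2 := congrArg Prod.snd hfix
    rw [div_eq_iff (by exact_mod_cast hK.ne')] at h2
    rw [hz.1]
    linear_combination -h2
  · have hL : dampedSymbol m g ε q ≠ 0 := fun h0 => by
      have h1 := abs_undampedSymbol_le m g ε q
      rw [h0, norm_zero] at h1
      exact undampedSymbol_ne_zero hirr hq (abs_nonpos_iff.1 h1)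
    have h1 := hY q
    simp only [truncInverse, if_pos hq] at h1
    have h2 : dampedSymbol m g ε q * coef X.1 q = symA q * coef (G X) q +
      (K * X.2.im * (symB q * coef X.1 q) + K * X.2.re * (symD q * coef X.1 q)) := by
      conv_lhs => rw [h1]
      field_simp
    have h3 : dampedSymbol m g ε q = ((q.2 : ℂ) ^ 2 + m - (1 + m) * (q.1 : ℂ) ^ 2) +
        (ε * g * (q.1 * (q.2 : ℂ) ^ 2)) * Complex.I := by
      rw [dampedSymbol, Complex.mk_eq_add_mul_I, undampedSymbol]
      push_cast
      rfl
    rw [h3] at h2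
    rw [hz.1, hz.2]
    simp only [symA, symB, symD] at h2
    push_cast
    linear_combination h2

/-! ### Rapidly decreasing coefficients and their Fourier series -/

/-- The polynomial weight `1 + |n| + |k|`. -/
def polyWeight (q : ℤ × ℤ) : ℝ := 1 + |(q.1 : ℝ)| + |(q.2 : ℝ)|

theorem one_le_polyWeight (q : ℤ × ℤ) : 1 ≤ polyWeight q := by
  have := abs_nonneg (q.1 : ℝ)
  have := abs_nonneg (q.2 : ℝ)
  unfold polyWeight
  linarith

theorem exists_polyWeight_pow_le (j : ℕ) :
    ∃ C : ℝ, 0 < C ∧ ∀ q, polyWeight q ^ j ≤ C * expWeight q := by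
  obtain ⟨C, hC⟩ := (tendsto_pow_const_div_const_pow_of_one_lt j
    (one_lt_two : (1 : ℝ) < 2)).bddAbove_range
  refine ⟨2 * |C| + 1, by positivity, fun q => ?_⟩
  set N := q.1.natAbs + q.2.natAbs with hN
  have h : ((N + 1 : ℕ) : ℝ) ^ j / 2 ^ (N + 1) ≤ C := hC ⟨N + 1, rfl⟩
  rw [div_le_iff₀ (by positivity)] at h
  have e : polyWeight q = ((N + 1 : ℕ) : ℝ) := by
    rw [polyWeight, hN]
    push_cast
    rw [Nat.cast_natAbs, Nat.cast_natAbs]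
    push_cast
    ring
  rw [e]
  have hW : expWeight q = 2 ^ N := rfl
  rw [hW]
  have h2 : (0 : ℝ) < 2 ^ N := by positivity
  have h3 := le_abs_self C
  rw [pow_succ (2 : ℝ) N] at h
  nlinarith

/-- Coefficients decreasing faster than any power. -/
def IsRapid (a : ℤ × ℤ → ℂ) : Prop := ∀ j : ℕ, Summable fun q => polyWeight q ^ j * ‖a q‖

theorem isRapid_coef (b : Wiener) : IsRapid (coef b) := fun j => by
  obtain ⟨C, -, hC⟩ := exists_polyWeight_pow_le j
  refine Summable.of_nonneg_of_le (fun q => ?_) (fun q => ?_)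
    ((hasSum_norm_coef b).summable.mul_left C)
  · have := one_le_polyWeight q
    positivity
  · rw [← mul_assoc]
    gcongr
    exact hC q

theorem IsRapid.mul {a g : ℤ × ℤ → ℂ} (ha : IsRapid a) (hg : ∀ q, ‖g q‖ ≤ polyWeight q) :
    IsRapid fun q => g q * a q := fun j => by
  have h0 := fun q => zero_le_one.trans (one_le_polyWeight q)
  refine Summable.of_nonneg_of_le (fun q => mul_nonneg (pow_nonneg (h0 q) _) (norm_nonneg _))
    (fun q => ?_) (ha (j + 1))
  rw [norm_mul, pow_succ, mul_assoc]
  gcongr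
  · exact pow_nonneg (h0 q) _
  · exact hg q

/-- The symbol of `∂_t`. -/
def symT (q : ℤ × ℤ) : ℂ := Complex.I * q.1

/-- The symbol of `∂_x`. -/
def symX (q : ℤ × ℤ) : ℂ := Complex.I * q.2

theorem norm_symT_le (q : ℤ × ℤ) : ‖symT q‖ ≤ polyWeight q := by
  have := abs_nonneg (q.2 : ℝ)
  simp only [symT, polyWeight, norm_mul, Complex.norm_I, Complex.norm_intCast, one_mul]
  linarith

theorem norm_symX_le (q : ℤ × ℤ) : ‖symX q‖ ≤ polyWeight q := by
  have := abs_nonneg (q.1 : ℝ)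
  simp only [symX, polyWeight, norm_mul, Complex.norm_I, Complex.norm_intCast, one_mul]
  linarith

/-- The exponential `e^{i(nt+kx)}`. -/
def wave (t x : ℝ) (q : ℤ × ℤ) : ℂ := Complex.exp (Complex.I * (q.1 * t + q.2 * x))

theorem norm_wave (t x : ℝ) (q : ℤ × ℤ) : ‖wave t x q‖ = 1 := by
  have : Complex.I * (q.1 * t + q.2 * x : ℂ) = ((q.1 * t + q.2 * x : ℝ) : ℂ) * Complex.I := by
    push_cast; ring
  rw [wave, this, Complex.norm_exp_ofReal_mul_I]

theorem wave_add (t x : ℝ) (r s : ℤ × ℤ) : wave t x (r + s) = wave t x r * wave t x s := by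
  rw [wave, wave, wave, ← Complex.exp_add]
  congr 1
  simp only [Prod.fst_add, Prod.snd_add]
  push_cast
  ring

/-- The function with Fourier coefficients `a`. -/
def waveSum (a : ℤ × ℤ → ℂ) (t x : ℝ) : ℂ := ∑' q, a q * wave t x q

theorem IsRapid.summable_norm {a : ℤ × ℤ → ℂ} (ha : IsRapid a) : Summable fun q => ‖a q‖ := by
  simpa using ha 0

theorem IsRapid.hasSum {a : ℤ × ℤ → ℂ} (ha : IsRapid a) (t x : ℝ) :
    HasSum (fun q => a q * wave t x q) (waveSum a t x) :=
  (Summable.of_norm_bounded ha.summable_norm fun q => by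
    rw [norm_mul, norm_wave, mul_one]).hasSum

/-- The derivative of the exponentials, as a linear form on `ℝ × ℝ`. -/
theorem hasFDerivAt_wave (c : ℂ) (q : ℤ × ℤ) (z : ℝ × ℝ) :
    HasFDerivAt (fun z : ℝ × ℝ => c * wave z.1 z.2 q)
      ((ContinuousLinearMap.fst ℝ ℝ ℝ).smulRight (symT q * c * wave z.1 z.2 q) +
        (ContinuousLinearMap.snd ℝ ℝ ℝ).smulRight (symX q * c * wave z.1 z.2 q)) z := by
  have h1 : HasFDerivAt (fun z : ℝ × ℝ => (z.1 : ℂ))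
      (Complex.ofRealCLM.comp (ContinuousLinearMap.fst ℝ ℝ ℝ)) z :=
    Complex.ofRealCLM.hasFDerivAt.comp z hasFDerivAt_fst
  have h2 : HasFDerivAt (fun z : ℝ × ℝ => (z.2 : ℂ))
      (Complex.ofRealCLM.comp (ContinuousLinearMap.snd ℝ ℝ ℝ)) z :=
    Complex.ofRealCLM.hasFDerivAt.comp z hasFDerivAt_snd
  have h3 := ((((h1.const_mul (q.1 : ℂ)).add (h2.const_mul (q.2 : ℂ))).const_mul
    Complex.I).cexp).const_mul c
  refine h3.congr_fderiv ?_
  ext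
  · simp [wave, symT]; ring
  · simp [wave, symX]; ring

theorem IsRapid.hasFDerivAt {a : ℤ × ℤ → ℂ} (ha : IsRapid a) (z : ℝ × ℝ) :
    HasFDerivAt (fun z : ℝ × ℝ => waveSum a z.1 z.2)
      ((ContinuousLinearMap.fst ℝ ℝ ℝ).smulRight (waveSum (fun q => symT q * a q) z.1 z.2) +
        (ContinuousLinearMap.snd ℝ ℝ ℝ).smulRight (waveSum (fun q => symX q * a q) z.1 z.2))
      z := by
  have hT := ha.mul norm_symT_le
  have hX := ha.mul norm_symX_le
  have h := hasFDerivAt_tsum (𝕜 := ℝ) (hT.summable_norm.add hX.summable_norm)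
    (fun q z => hasFDerivAt_wave (a q) q z) (fun q z => ?_) (x₀ := z) (ha.hasSum z.1 z.2).summable z
  · refine h.congr_fderiv ?_
    refine HasSum.tsum_eq ?_
    exact ((ContinuousLinearMap.smulRightL ℝ (ℝ × ℝ) ℂ
        (ContinuousLinearMap.fst ℝ ℝ ℝ)).hasSum (hT.hasSum z.1 z.2)).add
      ((ContinuousLinearMap.smulRightL ℝ (ℝ × ℝ) ℂ
        (ContinuousLinearMap.snd ℝ ℝ ℝ)).hasSum (hX.hasSum z.1 z.2))
  · refine (norm_add_le _ _).trans (add_le_add ?_ ?_)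
    · rw [ContinuousLinearMap.norm_smulRight_apply, norm_mul (_ * _), norm_wave, mul_one]
      exact mul_le_of_le_one_left (norm_nonneg _) (ContinuousLinearMap.norm_fst_le ℝ ℝ ℝ)
    · rw [ContinuousLinearMap.norm_smulRight_apply, norm_mul (_ * _), norm_wave, mul_one]
      exact mul_le_of_le_one_left (norm_nonneg _) (ContinuousLinearMap.norm_snd_le ℝ ℝ ℝ)

theorem IsRapid.contDiff {a : ℤ × ℤ → ℂ} (ha : IsRapid a) (j : ℕ) :
    ContDiff ℝ j fun z : ℝ × ℝ => waveSum a z.1 z.2 := by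
  induction j generalizing a with
  | zero =>
    rw [Nat.cast_zero, contDiff_zero]
    exact continuous_iff_continuousAt.2 fun z => (ha.hasFDerivAt z).continuousAt
  | succ j ih =>
    rw [Nat.cast_add, Nat.cast_one, contDiff_succ_iff_hasFDerivAt]
    exact ⟨_, (contDiff_const.smulRight (ih (ha.mul norm_symT_le))).add
      (contDiff_const.smulRight (ih (ha.mul norm_symX_le))), ha.hasFDerivAt⟩

theorem contDiff_re_scaled {F : ℝ → ℝ → ℂ} {j : ℕ} (hF : ContDiff ℝ j fun z : ℝ × ℝ => F z.1 z.2)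
    (r ω : ℝ) : ContDiff ℝ j fun z : ℝ × ℝ => r * (F (ω * z.1) z.2).re := by
  have h1 : ContDiff ℝ j fun z : ℝ × ℝ => (ω * z.1, z.2) := by fun_prop
  have h2 := Complex.reCLM.contDiff.comp (hF.comp h1)
  exact contDiff_const.mul h2

theorem IsRapid.hasDerivAt_fst {a : ℤ × ℤ → ℂ} (ha : IsRapid a) (t x : ℝ) :
    HasDerivAt (fun τ => waveSum a τ x) (waveSum (fun q => symT q * a q) t x) t := by
  have h := (ha.hasFDerivAt (t, x)).comp_hasDerivAt t
    ((hasDerivAt_id t).prodMk (hasDerivAt_const t x))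
  simpa [Function.comp_def] using h

theorem IsRapid.hasDerivAt_snd {a : ℤ × ℤ → ℂ} (ha : IsRapid a) (t x : ℝ) :
    HasDerivAt (fun y => waveSum a t y) (waveSum (fun q => symX q * a q) t x) x := by
  have h := (ha.hasFDerivAt (t, x)).comp_hasDerivAt x
    ((hasDerivAt_const x t).prodMk (hasDerivAt_id x))
  simpa [Function.comp_def] using h

theorem waveSum_add_two_pi_fst (a : ℤ × ℤ → ℂ) (t x : ℝ) :
    waveSum a (t + 2 * Real.pi) x = waveSum a t x := by
  refine tsum_congr fun q => ?_
  congr 1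
  rw [wave, wave, Complex.exp_eq_exp_iff_exists_int]
  exact ⟨q.1, by push_cast; ring⟩

theorem waveSum_add_two_pi_snd (a : ℤ × ℤ → ℂ) (t x : ℝ) :
    waveSum a t (x + 2 * Real.pi) = waveSum a t x := by
  refine tsum_congr fun q => ?_
  congr 1
  rw [wave, wave, Complex.exp_eq_exp_iff_exists_int]
  exact ⟨q.2, by push_cast; ring⟩

theorem IsAdmissible.waveSum_real {a : ℤ × ℤ → ℂ} (ha : IsAdmissible a) (t x : ℝ) :
    ((waveSum a t x).re : ℂ) = waveSum a t x := by
  rw [← Complex.conj_eq_iff_re, waveSum, Complex.conj_tsum, ← (Equiv.neg (ℤ × ℤ)).tsum_eq]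
  refine tsum_congr fun q => ?_
  rw [map_mul, Equiv.neg_apply, ha.conj]
  congr 1
  rw [wave, wave, ← Complex.exp_conj]
  congr 1
  simp
  ring

theorem IsAdmissible.waveSum_neg {a : ℤ × ℤ → ℂ} (ha : IsAdmissible a) (t x : ℝ) :
    waveSum a t (-x) = -waveSum a t x := by
  rw [waveSum, waveSum, ← tsum_neg, ← reflectSnd.toEquiv.tsum_eq]
  refine tsum_congr fun q => ?_
  change a (q.1, -q.2) * wave t (-x) (q.1, -q.2) = _
  rw [ha.odd]
  simp [wave]

theorem IsAdmissible.waveSum_zero {a : ℤ × ℤ → ℂ} (ha : IsAdmissible a) (t : ℝ) :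
    waveSum a t 0 = 0 := by
  have h := ha.waveSum_neg t 0
  rw [neg_zero] at h
  linear_combination (1 / 2) * h

theorem IsAdmissible.waveSum_pi {a : ℤ × ℤ → ℂ} (ha : IsAdmissible a) (t : ℝ) :
    waveSum a t Real.pi = 0 := by
  have h := ha.waveSum_neg t Real.pi
  rw [← waveSum_add_two_pi_snd a t (-Real.pi)] at h
  rw [show -Real.pi + 2 * Real.pi = Real.pi by ring] at h
  linear_combination (1 / 2) * h

theorem waveSum_coef_add (b c : Wiener) (t x : ℝ) :
    waveSum (coef (b + c)) t x = waveSum (coef b) t x + waveSum (coef c) t x := by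
  have h := ((isRapid_coef b).hasSum t x).add ((isRapid_coef c).hasSum t x)
  rw [← h.tsum_eq]
  exact tsum_congr fun q => by rw [coef_add, add_mul]

theorem waveSum_coef_smul (r : ℝ) (b : Wiener) (t x : ℝ) :
    waveSum (coef (r • b)) t x = r * waveSum (coef b) t x := by
  rw [waveSum, waveSum, ← tsum_mul_left]
  exact tsum_congr fun q => by rw [coef_real_smul, mul_assoc]

theorem norm_wave_le (t x : ℝ) (q : ℤ × ℤ) : ‖wave t x q‖ ≤ expWeight q := by
  rw [norm_wave]
  exact one_le_expWeight q

theorem waveSum_conv (b c : Wiener) (t x : ℝ) :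
    waveSum (coef (conv b c)) t x = waveSum (coef b) t x * waveSum (coef c) t x := by
  have h := pairing_conv (wave t x) (norm_wave_le t x) b c
  rw [pairing_apply] at h
  rw [waveSum, waveSum, waveSum, h, tsum_mul_tsum_of_summable_norm
    ((isRapid_coef b).hasSum t x).summable.norm ((isRapid_coef c).hasSum t x).summable.norm]
  refine tsum_congr fun y => ?_
  rw [wave_add]
  ring

theorem waveSum_convPow (b : Wiener) (j : ℕ) (t x : ℝ) :
    waveSum (coef (convPow b j)) t x = waveSum (coef b) t x ^ j := by
  induction j with
  | zero =>
    have h := pairing_monomialW (wave t x) (norm_wave_le t x) 0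
    rw [pairing_apply] at h
    rw [convPow, waveSum, h, pow_zero]
    simp [wave]
  | succ j ih => rw [convPow, waveSum_conv, ih, pow_succ']

/-! ### Sine expansions and the Sobolev norm -/

/-- The two indices `(n, k)` and `(n, -k)` carried by `sin (kx)`. -/
def sineIndex : (ℤ × ℕ+) ⊕ (ℤ × ℕ+) → ℤ × ℤ :=
  Sum.elim (fun q => (q.1, (q.2 : ℕ))) (fun q => (q.1, -(q.2 : ℕ)))

theorem sineIndex_injective : Function.Injective sineIndex := by
  rintro (⟨n, k⟩ | ⟨n, k⟩) (⟨n', k'⟩ | ⟨n', k'⟩) h <;>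
    simp only [sineIndex, Sum.elim_inl, Sum.elim_inr, Prod.mk.injEq] at h <;>
    obtain ⟨rfl, h⟩ := h
  · have : k = k' := PNat.coe_injective (by exact_mod_cast h)
    rw [this]
  · have := k.pos
    have := k'.pos
    omega
  · have := k.pos
    have := k'.pos
    omega
  · have : k = k' := PNat.coe_injective (by exact_mod_cast neg_injective h)
    rw [this]

theorem mem_range_sineIndex {q : ℤ × ℤ} (hq : q.2 ≠ 0) : q ∈ Set.range sineIndex := by
  obtain ⟨n, k⟩ := q
  have h0 : 0 < k.natAbs := Int.natAbs_pos.2 hq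
  rcases Int.natAbs_eq k with h | h
  · exact ⟨Sum.inl (n, ⟨k.natAbs, h0⟩), Prod.ext rfl h.symm⟩
  · exact ⟨Sum.inr (n, ⟨k.natAbs, h0⟩), Prod.ext rfl h.symm⟩

/-- The coefficients of the expansion in the functions `e^{int} sin (kx)`. -/
def sineCoef (a : ℤ × ℤ → ℂ) (q : ℤ × ℕ+) : ℂ := 2 * Complex.I * a (q.1, (q.2 : ℕ))

theorem hasSum_sineCoef {a : ℤ × ℤ → ℂ} (ha : IsAdmissible a) (hr : IsRapid a) (t x : ℝ) :
    HasSum (fun q : ℤ × ℕ+ => sineCoef a q * Complex.exp (Complex.I * (q.1 : ℂ) * (t : ℂ)) *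
      (Real.sin ((q.2 : ℕ) * x) : ℂ)) (waveSum a t x) := by
  have h1 : HasSum ((fun q => a q * wave t x q) ∘ sineIndex) (waveSum a t x) := by
    rw [sineIndex_injective.hasSum_iff]
    · exact hr.hasSum t x
    · intro q hq
      have : q.2 = 0 := by
        by_contra h
        exact hq (mem_range_sineIndex h)
      simp [ha.snd_zero this]
  have hl := (h1.summable.comp_injective Sum.inl_injective).hasSum
  have hrr := (h1.summable.comp_injective Sum.inr_injective).hasSum
  have e := h1.unique (hl.sum hrr)
  rw [e]
  refine (congrArg (HasSum · _) (funext fun q => ?_)).mpr (hl.add hrr)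
  have h2 := ha.odd (q.1, ((q.2 : ℕ) : ℤ))
  simp only [Function.comp_apply, sineIndex, Sum.elim_inl, Sum.elim_inr, sineCoef, wave]
  simp only at h2
  rw [h2, Complex.ofReal_sin, Complex.sin]
  have e1 : Complex.I * ((q.1 : ℂ) * t + (((q.2 : ℕ) : ℤ) : ℂ) * x) =
      Complex.I * q.1 * t + (((q.2 : ℕ) * x : ℝ) : ℂ) * Complex.I := by push_cast; ring
  have e2 : Complex.I * ((q.1 : ℂ) * t + ((-((q.2 : ℕ) : ℤ) : ℤ) : ℂ) * x) =
      Complex.I * q.1 * t + -(((q.2 : ℕ) * x : ℝ) : ℂ) * Complex.I := by push_cast; ring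
  rw [e1, e2, Complex.exp_add, Complex.exp_add]
  linear_combination (a (q.1, ((q.2 : ℕ) : ℤ)) * Complex.exp (Complex.I * q.1 * t) *
    (Complex.exp (-(((q.2 : ℕ) * x : ℝ) : ℂ) * Complex.I) -
      Complex.exp ((((q.2 : ℕ) * x : ℝ) : ℂ) * Complex.I))) * Complex.I_mul_I

theorem xsWeight_le {s : ℝ} {J : ℕ} (hs : 0 ≤ s) (hsJ : s ≤ J) (q : ℤ × ℕ+) :
    xsWeight s q ≤ 2 * (polyWeight (q.1, (q.2 : ℕ)) ^ J) ^ 2 := by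
  have h1 := one_le_polyWeight (q.1, (q.2 : ℕ))
  have key : ∀ y : ℝ, 0 ≤ y → y ≤ polyWeight (q.1, (q.2 : ℕ)) →
      y ^ (2 * s) ≤ (polyWeight (q.1, (q.2 : ℕ)) ^ J) ^ 2 := fun y hy hle => by
    calc y ^ (2 * s) ≤ polyWeight (q.1, (q.2 : ℕ)) ^ (2 * s) :=
          Real.rpow_le_rpow hy hle (by linarith)
      _ ≤ polyWeight (q.1, (q.2 : ℕ)) ^ ((J * 2 : ℕ) : ℝ) :=
          Real.rpow_le_rpow_of_exponent_le h1 (by push_cast; linarith)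
      _ = _ := by rw [Real.rpow_natCast, pow_mul]
  have h2 := key |(q.1 : ℝ)| (abs_nonneg _) (by
    simp only [polyWeight]
    linarith [abs_nonneg (((q.2 : ℕ) : ℤ) : ℝ)])
  have h3 := key ((q.2 : ℕ) : ℝ) (Nat.cast_nonneg _) (by
    simp only [polyWeight, Int.cast_natCast, Nat.abs_cast]
    linarith [abs_nonneg (q.1 : ℝ)])
  unfold xsWeight
  linarith

theorem exists_xsNorm_le (J : ℕ) :
    ∃ C : ℝ, 0 < C ∧ ∀ (b : Wiener), IsAdmissible (coef b) → ∀ s : ℝ, 0 ≤ s → s ≤ J →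
      XsNormLE s (fun t x => (waveSum (coef b) t x).re) (C * ‖b‖) := by
  obtain ⟨C, hC, hCw⟩ := exists_polyWeight_pow_le J
  refine ⟨4 * C, by positivity, fun b hb s hs hsJ => ⟨sineCoef (coef b), ?_, ?_⟩⟩
  all_goals
    have hterm : ∀ q : ℤ × ℕ+, xsWeight s q * ‖sineCoef (coef b) q‖ ^ 2 ≤
        8 * C ^ 2 * ‖b‖ * (expWeight (q.1, (q.2 : ℕ)) * ‖coef b (q.1, (q.2 : ℕ))‖) := fun q => by
      have h1 := xsWeight_le hs hsJ q
      have h2 := hCw (q.1, (q.2 : ℕ))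
      have h3 := one_le_polyWeight (q.1, (q.2 : ℕ))
      have h4 : expWeight (q.1, (q.2 : ℕ)) * ‖coef b (q.1, (q.2 : ℕ))‖ ≤ ‖b‖ := by
        rw [expWeight_mul_norm_coef]
        exact lp.norm_apply_le_norm one_ne_zero b _
      have h5 := expWeight_pos (q.1, (q.2 : ℕ))
      have e : ‖sineCoef (coef b) q‖ = 2 * ‖coef b (q.1, (q.2 : ℕ))‖ := by simp [sineCoef]
      rw [e]
      calc _ ≤ 2 * (C * expWeight (q.1, (q.2 : ℕ))) ^ 2 *
            (2 * ‖coef b (q.1, (q.2 : ℕ))‖) ^ 2 := by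
            gcongr
            refine h1.trans ?_
            gcongr
        _ = 8 * C ^ 2 * (expWeight (q.1, (q.2 : ℕ)) * ‖coef b (q.1, (q.2 : ℕ))‖) *
            (expWeight (q.1, (q.2 : ℕ)) * ‖coef b (q.1, (q.2 : ℕ))‖) := by ring
        _ ≤ _ := by gcongr
    have hinj : Function.Injective fun q : ℤ × ℕ+ => ((q.1, (q.2 : ℕ)) : ℤ × ℤ) :=
      sineIndex_injective.comp Sum.inl_injective
    have hsum : Summable fun q : ℤ × ℕ+ =>
        expWeight (q.1, (q.2 : ℕ)) * ‖coef b (q.1, (q.2 : ℕ))‖ :=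
      (hasSum_norm_coef b).summable.comp_injective hinj
    have hnn : ∀ q : ℤ × ℕ+, 0 ≤ xsWeight s q * ‖sineCoef (coef b) q‖ ^ 2 := fun q => by
      unfold xsWeight
      positivity
    have hS := Summable.of_nonneg_of_le hnn hterm (hsum.mul_left _)
  · refine ⟨fun n k => ?_, hS, fun t x => ?_⟩
    · have h1 := hb.conj (-n, -((k : ℕ) : ℤ))
      have h2 := hb.odd (-n, ((k : ℕ) : ℤ))
      simp only [Prod.neg_mk, neg_neg] at h1 h2
      simp only [sineCoef, map_mul, Complex.conj_I, h1, h2, map_ofNat]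
      ring
    · rw [hb.waveSum_real]
      exact hasSum_sineCoef hb (isRapid_coef b) t x
  · have hle : ∑' q : ℤ × ℕ+, expWeight (q.1, (q.2 : ℕ)) * ‖coef b (q.1, (q.2 : ℕ))‖ ≤ ‖b‖ := by
      rw [← (hasSum_norm_coef b).tsum_eq]
      exact tsum_comp_le_tsum_of_inj (hasSum_norm_coef b).summable
        (fun q => mul_nonneg (expWeight_pos q).le (norm_nonneg _)) hinj
    have h1 := hS.tsum_le_tsum hterm (hsum.mul_left _)
    rw [tsum_mul_left] at h1
    refine Real.sqrt_le_iff.2 ⟨by positivity, h1.trans ?_⟩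
    calc _ ≤ 8 * C ^ 2 * ‖b‖ * ‖b‖ := by gcongr
      _ ≤ _ := by nlinarith [mul_nonneg (sq_nonneg C) (sq_nonneg ‖b‖)]

/-! ### From the coefficients to the solution of the equation -/

/-- The primitive in time of a function without time-independent modes (the coefficients with
`n = 0` are set to `0`). -/
def primitiveT (b : Wiener) : Wiener :=
  multiplier (fun q => (symT q)⁻¹) 1 (fun q => by
    rcases eq_or_ne q.1 0 with h | h
    · simp [symT, h]
    · have := one_le_abs_of_ne_zero h
      simp only [symT, norm_inv, norm_mul, Complex.norm_I, one_mul, Complex.norm_intCast]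
      exact inv_le_one_of_one_le₀ this) b

theorem coef_primitiveT (b : Wiener) (q : ℤ × ℤ) :
    coef (primitiveT b) q = (symT q)⁻¹ * coef b q := coef_multiplier _ _ _ _ _

theorem norm_primitiveT_le (b : Wiener) : ‖primitiveT b‖ ≤ ‖b‖ := by
  exact (norm_multiplier_le _ 1 _ b).trans_eq (one_mul _)

theorem primitiveT_add (b c : Wiener) : primitiveT (b + c) = primitiveT b + primitiveT c := by
  refine wiener_ext fun q => ?_
  simp only [coef_primitiveT, coef_add, mul_add]

theorem conj_symT_neg (q : ℤ × ℤ) : (starRingEnd ℂ) (symT (-q)) = symT q := by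
  simp [symT]

theorem conj_symX_neg (q : ℤ × ℤ) : (starRingEnd ℂ) (symX (-q)) = symX q := by
  simp [symX]

theorem IsAdmissible.primitiveT {b : Wiener} (hb : IsAdmissible (coef b)) :
    IsAdmissible (coef (primitiveT b)) := by
  rw [show coef (_root_.primitiveT b) = fun q => (symT q)⁻¹ * coef b q from
    funext (coef_primitiveT b)]
  exact hb.mul (fun q => by rw [map_inv₀, conj_symT_neg]) (fun q => rfl)

/-- The coefficients of the time derivative of the primitive: no mode with `n = 0` is lost. -/
theorem symT_mul_coef_primitiveT {b : Wiener} (hb : IsAdmissible (coef b)) (q : ℤ × ℤ) :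
    symT q * coef (primitiveT b) q = coef b q := by
  rw [coef_primitiveT]
  by_cases h : q.1 = 0
  · rw [hb.parity q (by simp [h])]
    simp
  · have : symT q ≠ 0 := mul_ne_zero Complex.I_ne_zero (by exact_mod_cast h)
    field_simp

theorem isAdmissible_coef_profile : IsAdmissible (coef profile) :=
  coef_profile' ▸ isAdmissible_profileCoef

theorem waveSum_primitiveT_profile (t x : ℝ) :
    waveSum (coef (primitiveT profile)) t x = ((Real.cos t * Real.sin x : ℝ) : ℂ) := by
  have h : ∀ q ∉ ({(1, 1), (1, -1), (-1, 1), (-1, -1)} : Finset (ℤ × ℤ)),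
      coef (primitiveT profile) q * wave t x q = 0 := by
    intro q hq
    rw [coef_primitiveT, coef_profile, profileCoef_of_not, mul_zero, zero_mul]
    rintro ⟨h1, h2⟩
    obtain ⟨n, k⟩ := q
    simp only [Finset.mem_insert, Finset.mem_singleton, Prod.mk.injEq] at hq h1 h2
    omega
  rw [waveSum, tsum_eq_sum h]
  rw [Finset.sum_insert (by decide), Finset.sum_insert (by decide), Finset.sum_insert (by decide),
    Finset.sum_singleton]
  simp only [coef_primitiveT, coef_profile, profileCoef, symT, wave]
  have hI : (Complex.I)⁻¹ = -Complex.I := Complex.inv_I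
  norm_num [hI]
  rw [Complex.cos, Complex.sin]
  have e1 : Complex.I * ((t : ℂ) + x) = t * Complex.I + x * Complex.I := by ring
  have e2 : Complex.I * ((t : ℂ) + -x) = t * Complex.I + -x * Complex.I := by ring
  have e3 : Complex.I * (-(t : ℂ) + x) = -t * Complex.I + x * Complex.I := by ring
  have e4 : Complex.I * (-(t : ℂ) + -x) = -t * Complex.I + -x * Complex.I := by ring
  rw [e1, e2, e3, e4]
  simp only [Complex.exp_add]
  ring

/-- The equation for the coefficients of `u / ρ`, in terms of those of `y = ∂_t u / (ρ ω)`. It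
merges the kernel modes with the nonresonant ones. -/
theorem coefficient_equation {p : ℕ} {m g ε : ℝ} {Y : Wiener} {z : ℂ}
    (hadm : IsAdmissible (coef Y)) (hY0 : ∀ q, ¬IsNonresonant q → coef Y q = 0)
    (hker : (g + z : ℂ) = 4 * coef (forcing p m Y (ε * z.im)) (1, 1))
    (hrange : ∀ q : ℤ × ℤ, IsNonresonant q →
      ((q.2 : ℂ) ^ 2 + m - (1 + m + ε * z.im) * (q.1 : ℂ) ^ 2 +
        Complex.I * (ε * (g + z.re) * (q.1 * (q.2 : ℂ) ^ 2))) * coef Y q =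
      ε * (Complex.I * q.1) * coef (forcing p m Y (ε * z.im)) q) (q : ℤ × ℤ) :
    ((1 + m + ε * z.im) * symT q ^ 2 - symX q ^ 2 -
        ε * (g + z.re) * (symT q * symX q ^ 2) + m) * coef (primitiveT (profile + Y)) q =
      ε * coef (forcing p m Y (ε * z.im)) q := by
  have hy : IsAdmissible (coef (profile + Y)) := isAdmissible_coef_profile.coef_add hadm
  have hF := isAdmissible_forcing p m hadm (ε * z.im)
  have hsym : ∀ q, ((1 + m + ε * z.im) * symT q ^ 2 - symX q ^ 2 -
        ε * (g + z.re) * (symT q * symX q ^ 2) + m : ℂ) =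
      (q.2 : ℂ) ^ 2 + m - (1 + m + ε * z.im) * (q.1 : ℂ) ^ 2 +
        Complex.I * (ε * (g + z.re) * (q.1 * (q.2 : ℂ) ^ 2)) := fun q => by
    simp only [symT, symX]
    linear_combination ((1 + m + ε * z.im) * (q.1 : ℂ) ^ 2 - (q.2 : ℂ) ^ 2 -
      ε * (g + z.re) * Complex.I * q.1 * (q.2 : ℂ) ^ 2) * Complex.I_sq
  by_cases hn : q.1 = 0
  · have he : Even q.1 := by simp [hn]
    rw [hy.primitiveT.parity q he, hF.parity q he]
    ring
  by_cases hk : q.2 = 0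
  · rw [hy.primitiveT.snd_zero hk, hF.snd_zero hk]
    ring
  have hn' : symT q ≠ 0 := mul_ne_zero Complex.I_ne_zero (by exact_mod_cast hn)
  by_cases hres : q.1.natAbs = 1 ∧ q.2.natAbs = 1
  · refine IsAdmissible.eq_of_kernel
      (a := fun q => ((1 + m + ε * z.im) * symT q ^ 2 - symX q ^ 2 -
        ε * (g + z.re) * (symT q * symX q ^ 2) + m) * coef (primitiveT (profile + Y)) q)
      (b := fun q => ε * coef (forcing p m Y (ε * z.im)) q)
      (hy.primitiveT.mul (fun q => ?_) (fun q => ?_))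
      (hF.mul (g := fun _ => (ε : ℂ)) (fun q => by simp) (fun q => rfl)) ?_ hres
    · simp [conj_symT_neg, conj_symX_neg]
    · simp [symT, symX]
    · have h0 : coef Y (1, 1) = 0 := hY0 _ fun h => h.2.2 ⟨rfl, rfl⟩
      have h1 : coef (primitiveT (profile + Y)) (1, 1) = Complex.I⁻¹ * (1 / 4) := by
        rw [coef_primitiveT, coef_add, coef_profile, h0]
        simp [symT, profileCoef]
      have h2 := hsym (1, 1)
      simp only at h2
      rw [h2, h1, Complex.inv_I]
      have h3 := Complex.re_add_im z
      push_cast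
      linear_combination (ε / 4 : ℂ) * hker + (-(ε / 4) * (g + z.re) : ℂ) * Complex.I_sq +
        (ε / 4 : ℂ) * h3
  · have hq : IsNonresonant q := ⟨hn, hk, hres⟩
    have h1 := hrange q hq
    have h2 := symT_mul_coef_primitiveT hy q
    rw [coef_add, coef_profile, profileCoef_of_not hres, zero_add] at h2
    rw [hsym]
    refine mul_left_cancel₀ hn' ?_
    rw [mul_left_comm, h2, h1, symT]
    ring

theorem IsRapid.hasDerivAt_re_fst {a : ℤ × ℤ → ℂ} (ha : IsRapid a) (r ω t x : ℝ) :
    HasDerivAt (fun τ => r * (waveSum a (ω * τ) x).re)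
      (r * ω * (waveSum (fun q => symT q * a q) (ω * t) x).re) t := by
  have h1 := Complex.reCLM.hasFDerivAt.comp_hasDerivAt _ (ha.hasDerivAt_fst (ω * t) x)
  have h2 := (h1.comp t ((hasDerivAt_id t).const_mul ω)).const_mul r
  refine (h2.congr_deriv ?_)
  simp only [Complex.reCLM_apply, mul_one]
  ring

theorem IsRapid.hasDerivAt_re_snd {a : ℤ × ℤ → ℂ} (ha : IsRapid a) (r ω t x : ℝ) :
    HasDerivAt (fun y => r * (waveSum a (ω * t) y).re)
      (r * (waveSum (fun q => symX q * a q) (ω * t) x).re) x :=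
  (Complex.reCLM.hasFDerivAt.comp_hasDerivAt _ (ha.hasDerivAt_snd (ω * t) x)).const_mul r

theorem solvesDampedWave_of_coefficients {p : ℕ} {m ρ ω α γ : ℝ} (hω : α * ω = ρ ^ (2 * p) * γ)
    {y : Wiener} (hy : IsAdmissible (coef y))
    (heq : ∀ q, ((ω : ℂ) ^ 2 * symT q ^ 2 - symX q ^ 2 -
        ρ ^ (2 * p) * γ * (symT q * symX q ^ 2) + m) * coef (primitiveT y) q =
      ρ ^ (2 * p) * (ω ^ (2 * p + 1) * coef (convPow y (2 * p + 1)) q)) :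
    SolvesDampedWave p α m (fun t x => ρ * (waveSum (coef (primitiveT y)) (ω * t) x).re) := by
  have h0 := isRapid_coef (primitiveT y)
  have hT := h0.mul norm_symT_le
  have hTT := hT.mul norm_symT_le
  have hX := h0.mul norm_symX_le
  have hXX := hX.mul norm_symX_le
  have hTXX := hXX.mul norm_symT_le
  refine ⟨_, _, _, _, _, fun t x => h0.hasDerivAt_re_fst ρ ω t x,
    fun t x => hT.hasDerivAt_re_fst (ρ * ω) ω t x, fun t x => h0.hasDerivAt_re_snd ρ ω t x,
    fun t x => hX.hasDerivAt_re_snd ρ ω t x, fun t x => hXX.hasDerivAt_re_fst ρ ω t x,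
    fun t x => ?_⟩
  set T := ω * t
  have e : (fun q => symT q * coef (primitiveT y) q) = coef y :=
    funext (symT_mul_coef_primitiveT hy)
  have hpow : waveSum (coef (convPow y (2 * p + 1))) T x =
      (((waveSum (coef y) T x).re ^ (2 * p + 1) : ℝ) : ℂ) := by
    rw [waveSum_convPow]
    push_cast
    rw [hy.waveSum_real]
  have hlin : (ω : ℂ) ^ 2 * waveSum (fun q => symT q * (symT q * coef (primitiveT y) q)) T x -
      waveSum (fun q => symX q * (symX q * coef (primitiveT y) q)) T x -
      ρ ^ (2 * p) * γ *
        waveSum (fun q => symT q * (symX q * (symX q * coef (primitiveT y) q))) T x +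
      m * waveSum (coef (primitiveT y)) T x =
      ρ ^ (2 * p) * (ω ^ (2 * p + 1) * waveSum (coef (convPow y (2 * p + 1))) T x) := by
    have h1 := ((((hTT.hasSum T x).mul_left ((ω : ℂ) ^ 2)).sub (hXX.hasSum T x)).sub
      ((hTXX.hasSum T x).mul_left ((ρ : ℂ) ^ (2 * p) * γ))).add ((h0.hasSum T x).mul_left (m : ℂ))
    have h2 := (((isRapid_coef (convPow y (2 * p + 1))).hasSum T x).mul_left
      ((ω : ℂ) ^ (2 * p + 1))).mul_left ((ρ : ℂ) ^ (2 * p))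
    refine h1.unique ((congrArg (HasSum · _) (funext fun q => ?_)).mpr h2)
    linear_combination wave T x q * heq q
  have hre := congrArg Complex.re hlin
  rw [hpow] at hre
  simp only [Complex.add_re, Complex.sub_re, ← Complex.ofReal_pow, ← Complex.ofReal_mul,
    Complex.re_ofReal_mul, Complex.ofReal_re] at hre
  rw [e, mul_pow, mul_pow]
  have e3 : ρ ^ (2 * p + 1) = ρ * ρ ^ (2 * p) := pow_succ' _ _
  rw [e3]
  linear_combination ρ * hre -
    ρ * (waveSum (fun q => symT q * (symX q * (symX q * coef (primitiveT y) q))) T x).re * hω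

/-! ### The solution for a given amplitude -/

set_option maxHeartbeats 400000 in
/-- The solution for one amplitude `ρ`, with quantitative control of the damping and of the
frequency. -/
theorem exists_periodic_solution {p : ℕ} (hp : 1 ≤ p) {m : ℝ} (hm : 0 < m) (hirr : Irrational m)
    (k₀ : ℕ) :
    ∃ M c C D : ℝ, 0 < M ∧ 0 < c ∧ 0 < C ∧ ∀ ρ : ℝ, 0 < ρ → ρ < M → ∃ α ω : ℝ,
      (c * ρ ^ (2 * p) ≤ α ∧ 0 < ω ∧ 1 < ω ^ 2 ∧ ω ^ 2 < m + 2 ∧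
        ∃ u v : ℝ → ℝ → ℝ,
          (∀ t x, u t x = ρ * Real.cos (ω * t) * Real.sin x + v (ω * t) x) ∧
          SolvesDampedWave p α m u ∧
          (∀ t, u t 0 = 0) ∧ (∀ t, u t Real.pi = 0) ∧
          ContDiff ℝ k₀ (fun z : ℝ × ℝ => u z.1 z.2) ∧
          (∀ t x, u (t + 2 * Real.pi / ω) x = u t x) ∧
          (∀ t x, u t (x + 2 * Real.pi) = u t x) ∧
          (∀ t x, v (t + 2 * Real.pi) x = v t x) ∧
          (∀ s : ℝ, (k₀ : ℝ) + 10 ≤ s → s ≤ (k₀ : ℝ) + 20 →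
            XsNormLE s v (C * ρ ^ (2 * (p : ℝ) + 1 / 2)))) ∧
        α ≤ D * ρ ^ (2 * p) ∧ |ω ^ 2 - (1 + m)| ≤ ρ ^ (2 * p) := by
  obtain ⟨g, C, ε₀, hg, hC, hε₀, hsol⟩ := exists_coefficients p hm hirr
  obtain ⟨CX, hCX, hXs⟩ := exists_xsNorm_le (k₀ + 20)
  set M : ℝ := min (min 1 m) (min ε₀ (min (1 / C) (g / (2 * C)))) with hM
  refine ⟨M, g / (2 * (m + 2)), CX * C, 2 * g, by positivity, by positivity, by positivity,
    fun ρ hρ hρM => ?_⟩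
  have hρ1 : ρ < 1 := hρM.trans_le ((min_le_left _ _).trans (min_le_left _ _))
  set ε := ρ ^ (2 * p) with hε_def
  have hε : 0 < ε := by positivity
  have hερ : ε ≤ ρ := by
    have := pow_le_pow_of_le_one hρ.le hρ1.le (show 1 ≤ 2 * p by omega)
    rwa [pow_one] at this
  have hεM : ε < M := hερ.trans_lt hρM
  have hε1 : ε < 1 := hερ.trans_lt hρ1
  have hεm : ε < m := hεM.trans_le ((min_le_left _ _).trans (min_le_right _ _))
  have hεC : C * ε ≤ 1 := by
    have : ε ≤ 1 / C := hεM.le.trans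
      ((min_le_right _ _).trans ((min_le_right _ _).trans (min_le_left _ _)))
    rw [le_div_iff₀ hC] at this
    linarith
  have hεg : C * ε ≤ g / 2 := by
    have : ε ≤ g / (2 * C) := hεM.le.trans
      ((min_le_right _ _).trans ((min_le_right _ _).trans (min_le_right _ _)))
    rw [le_div_iff₀ (by positivity)] at this
    linarith
  obtain ⟨Y, z, hYn, hzn, hadm, hY0, hker, hrange⟩ := hsol ε hε
    (hεM.trans_le ((min_le_right _ _).trans (min_le_left _ _)))
  have him := (Complex.abs_im_le_norm z).trans hzn
  have hre := abs_le.1 ((Complex.abs_re_le_norm z).trans (hzn.trans hεg))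
  have hσ : |ε * z.im| ≤ ε := by
    rw [abs_mul, abs_of_pos hε]
    exact mul_le_of_le_one_right hε.le (him.trans hεC)
  have hσ' := abs_le.1 hσ
  set ω := √(1 + m + ε * z.im) with hω_def
  have hω2 : ω ^ 2 = 1 + m + ε * z.im := Real.sq_sqrt (by linarith)
  have hω1 : 1 < ω := by
    rw [hω_def, Real.lt_sqrt zero_le_one]
    linarith
  have hω0 : 0 < ω := one_pos.trans hω1
  have hωm : ω < m + 2 := by nlinarith
  have hγ : g / 2 ≤ g + z.re := by linarith
  set α := ε * (g + z.re) / ω with hα_def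
  have hαω : α * ω = ε * (g + z.re) := div_mul_cancel₀ _ hω0.ne'
  have hy : IsAdmissible (coef (profile + Y)) := isAdmissible_coef_profile.coef_add hadm
  have hw := isRapid_coef (primitiveT (profile + Y))
  have hsplit : ∀ t x, ρ * (waveSum (coef (primitiveT (profile + Y))) t x).re =
      ρ * Real.cos t * Real.sin x + (waveSum (coef (ρ • primitiveT Y)) t x).re := fun t x => by
    rw [primitiveT_add, waveSum_coef_add, waveSum_primitiveT_profile, waveSum_coef_smul,
      Complex.add_re, Complex.ofReal_re, Complex.re_ofReal_mul]
    ring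
  refine ⟨α, ω, ⟨?_, hω0, by linarith, by linarith,
    fun t x => ρ * (waveSum (coef (primitiveT (profile + Y))) (ω * t) x).re,
    fun t x => (waveSum (coef (ρ • primitiveT Y)) t x).re, fun t x => hsplit _ x, ?_,
    fun t => ?_, fun t => ?_, ?_, fun t x => ?_, fun t x => ?_, fun t x => ?_,
    fun s hs1 hs2 => ?_⟩, ?_, ?_⟩
  · rw [hα_def, le_div_iff₀ hω0]
    calc g / (2 * (m + 2)) * ε * ω ≤ g / (2 * (m + 2)) * ε * (m + 2) := by gcongr
      _ = ε * (g / 2) := by field_simp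
      _ ≤ _ := by gcongr
  · refine solvesDampedWave_of_coefficients hαω hy fun q => ?_
    have h1 := coefficient_equation hadm hY0 hker hrange q
    rw [coef_forcing] at h1
    have h2 : (ω : ℂ) ^ 2 = 1 + m + ε * z.im := by exact_mod_cast hω2
    have h3 : (ε : ℂ) = (ρ : ℂ) ^ (2 * p) := by rw [hε_def]; push_cast; rfl
    rw [h2, ← h3]
    push_cast
    exact h1
  · simp only [hy.primitiveT.waveSum_zero, Complex.zero_re, mul_zero]
  · simp only [hy.primitiveT.waveSum_pi, Complex.zero_re, mul_zero]
  · exact contDiff_re_scaled (hw.contDiff k₀) ρ ω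
  · have : ω * (t + 2 * Real.pi / ω) = ω * t + 2 * Real.pi := by field_simp
    simp only [this, waveSum_add_two_pi_fst]
  · simp only [waveSum_add_two_pi_snd]
  · simp only [waveSum_add_two_pi_fst]
  · have hb := (hadm.primitiveT).coef_real_smul ρ
    have hk : (0 : ℝ) ≤ k₀ := Nat.cast_nonneg _
    obtain ⟨c, hc, hcn⟩ := hXs _ hb s (by linarith) (by push_cast; linarith)
    refine ⟨c, hc, hcn.trans ?_⟩
    have h1 : ‖ρ • primitiveT Y‖ ≤ ρ * (C * ε) := by
      rw [norm_smul, Real.norm_of_nonneg hρ.le]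
      gcongr
      exact (norm_primitiveT_le Y).trans hYn
    have h2 : ρ * ε ≤ ρ ^ (2 * (p : ℝ) + 1 / 2) := by
      have h3 : ρ * ε = ρ ^ (2 * (p : ℝ) + 1) := by
        rw [hε_def, ← pow_succ', ← Real.rpow_natCast]
        push_cast
        rfl
      rw [h3]
      exact Real.rpow_le_rpow_of_exponent_ge hρ hρ1.le (by linarith)
    calc CX * ‖ρ • primitiveT Y‖ ≤ CX * (ρ * (C * ε)) := by gcongr
      _ = CX * C * (ρ * ε) := by ring
      _ ≤ _ := by gcongr
  · rw [hα_def, div_le_iff₀ hω0]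
    have : ε * (g + z.re) ≤ 2 * g * ε := by nlinarith
    nlinarith [mul_pos hg hε]
  · rw [hω2, add_sub_cancel_left]
    exact hσ

end

theorem theorem1p1 (p : ℕ) (hp : 1 ≤ p) (m : ℝ) (hm : 0 < m) (hirr : Irrational m)
    (k₀ : ℕ) (hk₀ : 2 ≤ k₀) :
    ∃ M c C : ℝ, 0 < M ∧ 0 < c ∧ 0 < C ∧ ∃ α ω : ℝ → ℝ,
      (∀ ρ : ℝ, 0 < ρ → ρ < M →
        c * ρ ^ (2 * p) ≤ α ρ ∧
        0 < ω ρ ∧ 1 < ω ρ ^ 2 ∧ ω ρ ^ 2 < m + 2 ∧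
        ∃ u v : ℝ → ℝ → ℝ,
          (∀ t x, u t x = ρ * Real.cos (ω ρ * t) * Real.sin x + v (ω ρ * t) x) ∧
          SolvesDampedWave p (α ρ) m u ∧
          (∀ t, u t 0 = 0) ∧ (∀ t, u t Real.pi = 0) ∧
          ContDiff ℝ k₀ (fun z : ℝ × ℝ => u z.1 z.2) ∧
          (∀ t x, u (t + 2 * Real.pi / ω ρ) x = u t x) ∧
          (∀ t x, u t (x + 2 * Real.pi) = u t x) ∧
          (∀ t x, v (t + 2 * Real.pi) x = v t x) ∧
          (∀ s : ℝ, (k₀ : ℝ) + 10 ≤ s → s ≤ (k₀ : ℝ) + 20 →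
            XsNormLE s v (C * ρ ^ (2 * (p : ℝ) + 1 / 2)))) ∧
      Tendsto α (𝓝[>] 0) (𝓝[>] 0) ∧
      Tendsto (fun ρ => ω ρ ^ 2) (𝓝[>] 0) (𝓝 (1 + m)) := by
  obtain ⟨M, c, C, D, hM, hc, hC, h⟩ := exists_periodic_solution hp hm hirr k₀
  choose! α ω hαω hα hω using h
  have hnear : ∀ᶠ ρ : ℝ in 𝓝[>] 0, 0 < ρ ∧ ρ < M := Ioo_mem_nhdsGT hM
  have hpow : Tendsto (fun ρ : ℝ => ρ ^ (2 * p)) (𝓝[>] 0) (𝓝 0) := by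
    have h1 : Tendsto (fun ρ : ℝ => ρ ^ (2 * p)) (𝓝 0) (𝓝 (0 ^ (2 * p))) :=
      (continuous_pow (2 * p)).tendsto 0
    rw [zero_pow (by omega)] at h1
    exact h1.mono_left nhdsWithin_le_nhds
  have hpos : ∀ ρ : ℝ, 0 < ρ ∧ ρ < M → 0 < α ρ := fun ρ hρ =>
    (mul_pos hc (pow_pos hρ.1 _)).trans_le (hαω ρ hρ.1 hρ.2).1
  refine ⟨M, c, C, hM, hc, hC, α, ω, hαω, tendsto_nhdsWithin_iff.2 ⟨?_, ?_⟩, ?_⟩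
  · refine squeeze_zero' (hnear.mono fun ρ hρ => (hpos ρ hρ).le)
      (hnear.mono fun ρ hρ => hα ρ hρ.1 hρ.2) ?_
    simpa using hpow.const_mul D
  · exact hnear.mono hpos
  · rw [tendsto_iff_dist_tendsto_zero]
    refine squeeze_zero' (Eventually.of_forall fun ρ => dist_nonneg)
      (hnear.mono fun ρ hρ => ?_) hpow
    rw [Real.dist_eq]
    exact hω ρ hρ.1 hρ.2
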